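/- Let $Q$ be a Coxeter polyhedron of finite volume in hyperbolic space $H^n$, that is, an intersection of finitely many closed half-spaces, with nonempty interior and finite hyperbolic volume, all of whose dihedral angles are of the form $\pi/m$ with $m\geq 2$ an integer. A *wall* of $Q$ is a codimension one face, two walls *meet* if they have a common point in $H^n$ (ideal points do not count), and a *doubling wall* is a wall whose angles with all the other walls that it meets are even submultiples of $\pi$, i.e. of the form $\pi/(2m)$ with $m\geq 1$ an integer. Let $W=W(Q)$ be the group generated by the reflections in the walls of $Q$. For an integer $I\geq 1$, let $N(I)$ be the number of subgroups of $W$ of index $I$ that are generated by reflections, up to conjugacy by isometries of $H^n$. If $Q$ has three or more pairwise disjoint doubling walls, then $N(I)$ is bounded below by an exponential in $I$: there are real constants $c>0$ and $a>1$ (depending on $Q$) such that $N(I)\geq c\,a^{I}$ for all integers $I\geq 1$. -/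

import Mathlib

open scoped ENNReal

/-- The Minkowski bilinear form of signature `(n,1)` on `ℝ^{n,1}`; the coordinate `0` is timelike. -/
noncomputable def mink {n : ℕ} (x y : Fin (n + 1) → ℝ) : ℝ :=
  -(x 0 * y 0) + ∑ i : Fin n, x i.succ * y i.succ

/-- Hyperbolic space `H^n`, as the upper sheet of the two-sheeted hyperboloid in `ℝ^{n,1}`. -/
def Hyp (n : ℕ) : Type :=
  {x : Fin (n + 1) → ℝ // mink x x = -1 ∧ 0 < x 0}

/-- The hyperbolic distance: `cosh d(x,y) = -⟨x,y⟩`. -/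
noncomputable def hdist {n : ℕ} (x y : Hyp n) : ℝ :=
  Real.arcosh (-(mink x.1 y.1))

/-- The isometry group of `H^n`: all distance-preserving bijections. -/
def HypIsom (n : ℕ) : Subgroup (Equiv.Perm (Hyp n)) where
  carrier := {g | ∀ x y, hdist (g x) (g y) = hdist x y}
  mul_mem' := by
    intro a b ha hb x y
    rw [Equiv.Perm.mul_apply, Equiv.Perm.mul_apply, ha, hb]
  one_mem' := by
    intro x y
    rfl
  inv_mem' := by
    intro a ha x y
    have h := ha (a.symm x) (a.symm y)
    rw [Equiv.apply_symm_apply, Equiv.apply_symm_apply] at h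
    exact h.symm

/-- The linear reflection of `ℝ^{n,1}` in the orthogonal complement of a unit vector `e`. -/
noncomputable def minkReflect {n : ℕ} (e x : Fin (n + 1) → ℝ) : Fin (n + 1) → ℝ :=
  fun k => x k - 2 * mink x e * e k

theorem mink_comm {n : ℕ} (x y : Fin (n + 1) → ℝ) : mink x y = mink y x := by
  unfold mink
  rw [mul_comm (x 0)]
  congr 1
  exact Finset.sum_congr rfl fun i _ => mul_comm _ _

theorem mink_reflect_left {n : ℕ} (e x y : Fin (n + 1) → ℝ) :
    mink (minkReflect e x) y = mink x y - 2 * mink x e * mink e y := by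
  have h : ∑ i : Fin n, (x i.succ - 2 * mink x e * e i.succ) * y i.succ
      = ∑ i : Fin n, x i.succ * y i.succ - 2 * mink x e * ∑ i : Fin n, e i.succ * y i.succ := by
    rw [Finset.mul_sum, ← Finset.sum_sub_distrib]
    exact Finset.sum_congr rfl fun i _ => by ring
  have h1 : mink (minkReflect e x) y = -((x 0 - 2 * mink x e * e 0) * y 0)
      + ∑ i : Fin n, (x i.succ - 2 * mink x e * e i.succ) * y i.succ := rfl
  have h2 : mink x y = -(x 0 * y 0) + ∑ i : Fin n, x i.succ * y i.succ := rfl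
  have h3 : mink e y = -(e 0 * y 0) + ∑ i : Fin n, e i.succ * y i.succ := rfl
  rw [h1, h, h2, h3]
  ring

theorem mink_reflect_reflect {n : ℕ} (e : Fin (n + 1) → ℝ) (he : mink e e = 1)
    (x y : Fin (n + 1) → ℝ) : mink (minkReflect e x) (minkReflect e y) = mink x y := by
  rw [mink_reflect_left, mink_comm x, mink_comm e, mink_reflect_left, mink_reflect_left, he,
    mink_comm e x, mink_comm y x]
  ring

theorem minkReflect_invol {n : ℕ} (e : Fin (n + 1) → ℝ) (he : mink e e = 1)
    (x : Fin (n + 1) → ℝ) : minkReflect e (minkReflect e x) = x := by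
  funext k
  have h : mink (minkReflect e x) e = -mink x e := by
    rw [mink_reflect_left, he]; ring
  have h1 : minkReflect e (minkReflect e x) k
      = (x k - 2 * mink x e * e k) - 2 * mink (minkReflect e x) e * e k := rfl
  rw [h1, h]
  ring

/-- Two vectors of square `-1` whose product is negative lie on the same sheet. -/
theorem same_sheet {n : ℕ} (x y : Fin (n + 1) → ℝ) (hx : mink x x = -1) (hx0 : 0 < x 0)
    (hy : mink y y = -1) (hxy : mink x y < 0) : 0 < y 0 := by
  unfold mink at hx hy hxy
  have hcs := Finset.sum_mul_sq_le_sq_mul_sq Finset.univ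
    (fun i : Fin n => x i.succ) (fun i : Fin n => y i.succ)
  simp only [pow_two] at hcs
  by_contra hneg
  push Not at hneg
  set S := ∑ i : Fin n, x i.succ * y i.succ
  set X := ∑ i : Fin n, x i.succ * x i.succ
  set Y := ∑ i : Fin n, y i.succ * y i.succ
  have hX : X = x 0 * x 0 - 1 := by linarith
  have hY : Y = y 0 * y 0 - 1 := by linarith
  have hY0 : 0 ≤ Y := Finset.sum_nonneg fun i _ => mul_self_nonneg _
  have hX0 : 0 ≤ X := Finset.sum_nonneg fun i _ => mul_self_nonneg _
  have hp : x 0 * y 0 ≤ 0 := mul_nonpos_of_nonneg_of_nonpos hx0.le hneg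
  have hS : S < x 0 * y 0 := by linarith
  have hsq : (x 0 * y 0) * (x 0 * y 0) < S * S := by nlinarith
  have : X * Y = (x 0 * y 0) * (x 0 * y 0) - x 0 * x 0 - y 0 * y 0 + 1 := by
    rw [hX, hY]; ring
  nlinarith

/-- The reflection of `H^n` in the hyperplane orthogonal to a unit spacelike vector `e`. -/
noncomputable def hypReflection {n : ℕ} (e : Fin (n + 1) → ℝ) (he : mink e e = 1) : HypIsom n :=
  have hmaps : ∀ x : Hyp n,
      mink (minkReflect e x.1) (minkReflect e x.1) = -1 ∧ 0 < minkReflect e x.1 0 := by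
    intro x
    have h1 : mink (minkReflect e x.1) (minkReflect e x.1) = -1 := by
      rw [mink_reflect_reflect e he]; exact x.2.1
    refine ⟨h1, same_sheet x.1 _ x.2.1 x.2.2 h1 ?_⟩
    rw [mink_comm, mink_reflect_left, x.2.1, mink_comm e]
    nlinarith [mul_self_nonneg (mink x.1 e)]
  ⟨{ toFun := fun x => ⟨minkReflect e x.1, hmaps x⟩
     invFun := fun x => ⟨minkReflect e x.1, hmaps x⟩
     left_inv := fun x => Subtype.ext (minkReflect_invol e he x.1)
     right_inv := fun x => Subtype.ext (minkReflect_invol e he x.1) },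
    fun x y => congrArg (fun t => Real.arcosh (-t)) (mink_reflect_reflect e he x.1 y.1)⟩

/-- An isometry of `H^n` is a reflection if it is the reflection in some hyperplane. -/
def IsHypReflection {n : ℕ} (g : HypIsom n) : Prop :=
  ∃ (e : Fin (n + 1) → ℝ) (he : mink e e = 1), g = hypReflection e he

/-- The point of the hyperboloid lying over `v ∈ ℝ^n`. -/
noncomputable def hypLift {n : ℕ} (v : Fin n → ℝ) : Hyp n :=
  ⟨Fin.cons (Real.sqrt (1 + ∑ i, v i ^ 2)) v, by
    have h : 0 < 1 + ∑ i, v i ^ 2 :=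
      add_pos_of_pos_of_nonneg one_pos (Finset.sum_nonneg fun i _ => sq_nonneg _)
    constructor
    · simp only [mink, Fin.cons_zero, Fin.cons_succ]
      rw [Real.mul_self_sqrt h.le]
      simp only [pow_two]
      ring
    · simpa using h⟩

/-- Hyperbolic volume. In the coordinates `v = (x_1,…,x_n)` on the hyperboloid the Riemannian
volume element is `dx_1 ⋯ dx_n / x_0`, with `x_0 = √(1 + |v|²)`. -/
noncomputable def hypVolume {n : ℕ} (S : Set (Hyp n)) : ℝ≥0∞ :=
  ∫⁻ v in {v : Fin n → ℝ | hypLift v ∈ S}, ENNReal.ofReal (1 / Real.sqrt (1 + ∑ i, v i ^ 2))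

/-- A convex polyhedron in `H^n`: a finite intersection of closed half-spaces
`{x | ⟨x, e_i⟩ ≤ 0}`, given by its outward unit normals `e_i`. It has nonempty interior, and each
of the half-spaces contributes a wall, that is, a face of codimension one: the
`i`-th hyperplane contains a point at which all other inequalities are strict. -/
structure HypPolyhedron (n : ℕ) where
  /-- The number of walls. -/
  numWalls : ℕ
  /-- The outward unit normals of the walls. -/
  normal : Fin numWalls → (Fin (n + 1) → ℝ)
  normal_unit : ∀ i, mink (normal i) (normal i) = 1
  interior_nonempty : ∃ x : Hyp n, ∀ i, mink x.1 (normal i) < 0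
  wall_codim_one : ∀ i, ∃ x : Hyp n,
    mink x.1 (normal i) = 0 ∧ ∀ j, j ≠ i → mink x.1 (normal j) < 0

namespace HypPolyhedron

/-- The points of the polyhedron. -/
def carrier {n : ℕ} (Q : HypPolyhedron n) : Set (Hyp n) :=
  {x | ∀ i, mink x.1 (Q.normal i) ≤ 0}

/-- The `i`-th wall of the polyhedron (a subset of `H^n`, without ideal points). -/
def wall {n : ℕ} (Q : HypPolyhedron n) (i : Fin Q.numWalls) : Set (Hyp n) :=
  {x | x ∈ Q.carrier ∧ mink x.1 (Q.normal i) = 0}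

/-- Two walls are adjacent if they intersect in a face of codimension two: some common point of
theirs satisfies all the other inequalities strictly. -/
def Adjacent {n : ℕ} (Q : HypPolyhedron n) (i j : Fin Q.numWalls) : Prop :=
  i ≠ j ∧ ∃ x : Hyp n, mink x.1 (Q.normal i) = 0 ∧ mink x.1 (Q.normal j) = 0 ∧
    ∀ k, k ≠ i → k ≠ j → mink x.1 (Q.normal k) < 0

/-- The angle, measured inside the polyhedron, between two walls that meet. It is `π` minus the
angle between the outward normals. -/
noncomputable def angle {n : ℕ} (Q : HypPolyhedron n) (i j : Fin Q.numWalls) : ℝ :=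
  Real.arccos (-(mink (Q.normal i) (Q.normal j)))

/-- A Coxeter polyhedron: all dihedral angles are integral submultiples of `π`. -/
def IsCoxeter {n : ℕ} (Q : HypPolyhedron n) : Prop :=
  ∀ i j, Q.Adjacent i j → ∃ m : ℕ, 2 ≤ m ∧ Q.angle i j = Real.pi / m

/-- A doubling wall: its angles with the other walls that it meets in `H^n` are all even
submultiples of `π`. -/
def IsDoublingWall {n : ℕ} (Q : HypPolyhedron n) (i : Fin Q.numWalls) : Prop :=
  ∀ j, j ≠ i → (Q.wall i ∩ Q.wall j).Nonempty →
    ∃ m : ℕ, 1 ≤ m ∧ Q.angle i j = Real.pi / (2 * m : ℕ)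

/-- The group `W(Q)` generated by the reflections in the walls of `Q`. -/
def coxeterGroup {n : ℕ} (Q : HypPolyhedron n) : Subgroup (HypIsom n) :=
  Subgroup.closure (Set.range fun i => hypReflection (Q.normal i) (Q.normal_unit i))

/-- The subgroups of `W(Q)` of index `I` (finite, for `1 ≤ I`) that are generated by
reflections. -/
def reflectionSubgroups {n : ℕ} (Q : HypPolyhedron n) (I : ℕ) : Set (Subgroup (HypIsom n)) :=
  {G | G ≤ Q.coxeterGroup ∧ G.relIndex Q.coxeterGroup = I ∧
    ∃ S : Set (HypIsom n), (∀ g ∈ S, IsHypReflection g) ∧ Subgroup.closure S = G}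

end HypPolyhedron

/-- Conjugacy of subgroups by isometries of `H^n`. -/
def isomConj (n : ℕ) : Setoid (Subgroup (HypIsom n)) where
  r G G' := ∃ g : HypIsom n, G' = G.map (MulAut.conj g).toMonoidHom
  iseqv :=
    { refl := fun G => ⟨1, by rw [map_one]; exact (Subgroup.map_id G).symm⟩
      symm := by
        rintro G _ ⟨g, rfl⟩
        refine ⟨g⁻¹, ?_⟩
        rw [Subgroup.map_map]
        conv_lhs => rw [← Subgroup.map_id G]
        congr 1
        refine MonoidHom.ext fun x => ?_
        change x = g⁻¹ * (g * x * g⁻¹) * g⁻¹⁻¹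
        group
      trans := by
        rintro G _ _ ⟨g, rfl⟩ ⟨h, rfl⟩
        refine ⟨h * g, ?_⟩
        rw [Subgroup.map_map]
        rw [map_mul]
        rfl }

/-- `N(I)`: the number of subgroups of `W(Q)` of index `I` that are generated by reflections, up
to conjugacy by isometries of `H^n`. -/
noncomputable def numReflectionSubgroups {n : ℕ} (Q : HypPolyhedron n) (I : ℕ) : ℕ :=
  Nat.card (Quotient ((isomConj n).comap
    (Subtype.val : Q.reflectionSubgroups I → Subgroup (HypIsom n))))

/-!
The hyperplanes of a Coxeter polyhedron `Q` satisfy Andreev's theorem: the outward normals of any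
two walls have nonpositive product, and walls that are not adjacent have disjoint hyperplanes
(`HypPolyhedron.mink_normal_nonpos`, `HypPolyhedron.adjacent_of_mink_gt`). By Tits's theorem on
positive roots (`MirrorSystem.mink_lin_nonpos`), `W(Q)` is therefore the abstract Coxeter group `W`
whose labels are given by the dihedral angles (`MirrorSystem.rho_injective`), and the images of the
chamber `Q` cover `H^n` (`MirrorSystem.exists_lin_mem_chamber`).

The doubling walls have even or infinite labels with all other walls, and infinite labels with each
other. Hence a path with `I` vertices, whose edges are coloured by the three doubling walls so that
consecutive colours differ, carries an action of `W`: the generator of a doubling wall moves along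
the edges of its colour, and all other generators act trivially. Geometrically the path describes
the polyhedron glued from `I` copies of `Q` by successive doublings. The stabilizer of a vertex has
index `I` and is generated by the reflections in the walls of the copies of `Q` that are not
crossed by an edge (`ColouredPath.index_stab`, `ColouredPath.stab_eq_closure`). Leaving every
second colour free to be one of two gives `2 ^ ((I - 3) / 2)` different subgroups, the stabilizers
of the vertex `1` (`DoublingTriple.eq_of_stab_eq`).

It remains to see that an isometry class contains only polynomially many of these subgroups
(`MirrorSystem.card_le_of_conj`). All of them contain certain fixed reflections, the *probes*, in
walls of the glued polyhedron near the base copy of `Q`, and an isometry that commutes with the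
probes commutes with all of `W` (`MirrorSystem.commute_of_probe`). Suppose that `h` conjugates the
subgroup `G'` of one path to the stabilizer `G` of a vertex `p` of another path. As the images of
`Q` cover `H^n`, one may change `p` so that `h` moves the base point into `Q`. No mirror of `G'`
other than that of a probe separates the base point from its mirror image in the probe, so `h`
carries the probe to a reflection `t` such that no mirror of `G` other than that of `t` separates a
point of `Q` from its image under `t`. But a reduced gallery from `Q` to `t Q` has to leave the path
at a missing edge, and thereby crosses one of the generating reflections of `G`, which must be `t`
(`MirrorSystem.conj_eq_of_only_separating`). So there are at most `I * k` possible images for each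
of the `k` probes, where `k` is the number of walls, and these images and `p` determine `G'`.
-/

/-! ### The Minkowski form -/

section Minkowski

variable {n : ℕ}

theorem mink_add_left (x y z : Fin (n + 1) → ℝ) : mink (x + y) z = mink x z + mink y z := by
  simp only [mink, Pi.add_apply, add_mul, Finset.sum_add_distrib]
  ring

theorem mink_smul_left (c : ℝ) (x z : Fin (n + 1) → ℝ) : mink (c • x) z = c * mink x z := by
  simp only [mink, Pi.smul_apply, smul_eq_mul, mul_add, Finset.mul_sum, mul_assoc]
  ring

/-- The Minkowski form as a bilinear map. -/
noncomputable def minkForm (n : ℕ) :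
    (Fin (n + 1) → ℝ) →ₗ[ℝ] (Fin (n + 1) → ℝ) →ₗ[ℝ] ℝ :=
  LinearMap.mk₂ ℝ mink mink_add_left mink_smul_left
    (fun x y z => by rw [mink_comm, mink_add_left, mink_comm y, mink_comm z])
    (fun c x y => by rw [mink_comm, mink_smul_left, mink_comm y, smul_eq_mul])

theorem minkForm_apply (x y : Fin (n + 1) → ℝ) : minkForm n x y = mink x y := rfl

theorem mink_add_right (x y z : Fin (n + 1) → ℝ) : mink x (y + z) = mink x y + mink x z :=
  map_add (minkForm n x) y z

theorem mink_smul_right (c : ℝ) (x z : Fin (n + 1) → ℝ) : mink x (c • z) = c * mink x z :=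
  map_smul (minkForm n x) c z

theorem mink_neg_left (x z : Fin (n + 1) → ℝ) : mink (-x) z = -mink x z :=
  congrArg (fun f => f z) (map_neg (minkForm n) x)

theorem mink_neg_right (x z : Fin (n + 1) → ℝ) : mink x (-z) = -mink x z :=
  map_neg (minkForm n x) z

theorem mink_sub_left (x y z : Fin (n + 1) → ℝ) : mink (x - y) z = mink x z - mink y z :=
  congrArg (fun f => f z) (map_sub (minkForm n) x y)

theorem mink_sub_right (x y z : Fin (n + 1) → ℝ) : mink x (y - z) = mink x y - mink x z :=
  map_sub (minkForm n x) y z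

theorem mink_zero_left (z : Fin (n + 1) → ℝ) : mink 0 z = 0 := by
  simp [mink]

theorem mink_zero_right (z : Fin (n + 1) → ℝ) : mink z 0 = 0 := by
  simp [mink]

theorem mink_sum_left {ι : Type*} (s : Finset ι) (f : ι → Fin (n + 1) → ℝ)
    (z : Fin (n + 1) → ℝ) : mink (∑ i ∈ s, f i) z = ∑ i ∈ s, mink (f i) z := by
  have h := map_sum ((minkForm n).flip z) f s
  exact h

theorem continuous_mink_left (z : Fin (n + 1) → ℝ) : Continuous fun x => mink x z := by
  unfold mink
  fun_prop

/-- The Minkowski form is nondegenerate. -/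
theorem eq_zero_of_mink_eq_zero {x : Fin (n + 1) → ℝ} (h : ∀ y, mink x y = 0) : x = 0 := by
  have h0 := h (fun k => if k = 0 then -x 0 else x k)
  simp only [mink, Fin.succ_ne_zero, if_false, if_true] at h0
  have hs : 0 ≤ ∑ i : Fin n, x i.succ * x i.succ :=
    Finset.sum_nonneg fun i _ => mul_self_nonneg _
  have hx0 : x 0 * x 0 = 0 := by nlinarith [mul_self_nonneg (x 0)]
  have hs0 : ∑ i : Fin n, x i.succ * x i.succ = 0 := by nlinarith
  rw [Finset.sum_eq_zero_iff_of_nonneg fun i _ => mul_self_nonneg _] at hs0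
  funext k
  refine Fin.cases (mul_self_eq_zero.mp hx0) (fun i => ?_) k
  exact mul_self_eq_zero.mp (hs0 i (Finset.mem_univ _))

/-- The orthogonal complement of a timelike vector is positive definite. -/
theorem mink_self_pos_of_orthogonal {x u : Fin (n + 1) → ℝ} (hx : mink x x < 0)
    (hxu : mink x u = 0) (hu : u ≠ 0) : 0 < mink u u := by
  unfold mink at hx hxu ⊢
  have hcs := Finset.sum_mul_sq_le_sq_mul_sq Finset.univ
    (fun i : Fin n => x i.succ) (fun i : Fin n => u i.succ)
  simp only [pow_two] at hcs
  set S := ∑ i : Fin n, x i.succ * u i.succ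
  set X := ∑ i : Fin n, x i.succ * x i.succ
  have hU0 : 0 ≤ ∑ i : Fin n, u i.succ * u i.succ := Finset.sum_nonneg fun i _ => mul_self_nonneg _
  have hX0 : 0 ≤ X := Finset.sum_nonneg fun i _ => mul_self_nonneg _
  have hS : S = x 0 * u 0 := by linarith
  have hx0 : 0 < x 0 * x 0 := by linarith
  have hU : 0 < ∑ i : Fin n, u i.succ * u i.succ := by
    rcases hU0.lt_or_eq with h | h
    · exact h
    · exfalso
      rw [← h, hS] at hcs
      have h1 : x 0 * u 0 = 0 := mul_self_eq_zero.mp (by nlinarith [mul_self_nonneg (x 0 * u 0)])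
      have h2 : u 0 = 0 := by
        rcases mul_eq_zero.mp h1 with h2 | h2
        · rw [h2] at hx0; simp at hx0
        · exact h2
      have h3 := (Finset.sum_eq_zero_iff_of_nonneg fun i _ => mul_self_nonneg _).mp h.symm
      apply hu
      funext k
      exact Fin.cases h2 (fun i => mul_self_eq_zero.mp (h3 i (Finset.mem_univ _))) k
  set U := ∑ i : Fin n, u i.succ * u i.succ
  rw [hS] at hcs
  have h4 : (x 0 * x 0) * (u 0 * u 0) < (x 0 * x 0) * U := by nlinarith
  nlinarith [lt_of_mul_lt_mul_left h4 hx0.le]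

theorem mink_self_nonneg_of_orthogonal {x u : Fin (n + 1) → ℝ} (hx : mink x x < 0)
    (hxu : mink x u = 0) : 0 ≤ mink u u := by
  by_cases hu : u = 0
  · rw [hu, mink_zero_left]
  · exact (mink_self_pos_of_orthogonal hx hxu hu).le

/-- The Cauchy–Schwarz inequality in the orthogonal complement of a timelike vector. -/
theorem mink_sq_le_of_orthogonal {x u v : Fin (n + 1) → ℝ} (hx : mink x x < 0)
    (hxu : mink x u = 0) (hxv : mink x v = 0) :
    mink u v ^ 2 ≤ mink u u * mink v v := by
  by_cases hv : v = 0
  · simp [hv, mink_zero_right]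
  have hvv := mink_self_pos_of_orthogonal hx hxv hv
  have h := mink_self_nonneg_of_orthogonal (u := mink v v • u - mink u v • v) hx (by
    rw [mink_sub_right, mink_smul_right, mink_smul_right, hxu, hxv]; ring)
  simp only [mink_sub_left, mink_sub_right, mink_smul_left, mink_smul_right, mink_comm v u] at h
  have h2 : 0 ≤ mink v v * (mink u u * mink v v - mink u v ^ 2) := by nlinarith
  nlinarith [nonneg_of_mul_nonneg_right h2 hvv]

/-- Vectors of the open forward light cone have negative product. -/
theorem mink_neg_of_forward {x y : Fin (n + 1) → ℝ} (hx : mink x x < 0) (hx0 : 0 < x 0)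
    (hy : mink y y < 0) (hy0 : 0 < y 0) : mink x y < 0 := by
  unfold mink at *
  have hcs := Finset.sum_mul_sq_le_sq_mul_sq Finset.univ
    (fun i : Fin n => x i.succ) (fun i : Fin n => y i.succ)
  simp only [pow_two] at hcs
  set S := ∑ i : Fin n, x i.succ * y i.succ
  set X := ∑ i : Fin n, x i.succ * x i.succ
  set Y := ∑ i : Fin n, y i.succ * y i.succ
  have hY0 : 0 ≤ Y := Finset.sum_nonneg fun i _ => mul_self_nonneg _
  have hX0 : 0 ≤ X := Finset.sum_nonneg fun i _ => mul_self_nonneg _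
  have hp : 0 < x 0 * y 0 := mul_pos hx0 hy0
  by_contra hneg
  have h1 : x 0 * y 0 ≤ S := by linarith
  have h2 : (x 0 * y 0) * (x 0 * y 0) ≤ S * S := by nlinarith
  have h3 : X * Y < (x 0 * x 0) * (y 0 * y 0) := by nlinarith [mul_pos hx0 hx0, mul_pos hy0 hy0]
  nlinarith

/-- A timelike vector whose product with a forward timelike vector is negative is forward. -/
theorem forward_of_mink_neg {x y : Fin (n + 1) → ℝ} (hx : mink x x < 0) (hx0 : 0 < x 0)
    (hy : mink y y < 0) (hxy : mink x y < 0) : 0 < y 0 := by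
  rcases lt_trichotomy (y 0) 0 with h | h | h
  · have := mink_neg_of_forward hx hx0 (y := -y)
      (by rw [mink_neg_left, mink_neg_right]; linarith) (by simpa using h)
    rw [mink_neg_right] at this
    linarith
  · exfalso
    have h1 : 0 ≤ mink y y := by
      unfold mink
      rw [h]
      have : 0 ≤ ∑ i : Fin n, y i.succ * y i.succ := Finset.sum_nonneg fun i _ => mul_self_nonneg _
      linarith
    linarith
  · exact h

/-- Every vector of the open forward light cone is a positive multiple of a point of `H^n`. -/
theorem exists_hyp_smul {z : Fin (n + 1) → ℝ} (hz : mink z z < 0) (hz0 : 0 < z 0) :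
    ∃ (x : Hyp n) (c : ℝ), 0 < c ∧ x.1 = c • z := by
  have hs : 0 < Real.sqrt (-mink z z) := Real.sqrt_pos.mpr (by linarith)
  have hsq : Real.sqrt (-mink z z) * Real.sqrt (-mink z z) = -mink z z :=
    Real.mul_self_sqrt (by linarith)
  refine ⟨⟨(Real.sqrt (-mink z z))⁻¹ • z, ?_, ?_⟩, _, inv_pos.mpr hs, rfl⟩
  · rw [mink_smul_left, mink_smul_right]
    field_simp
    nlinarith
  · simpa using mul_pos (inv_pos.mpr hs) hz0

theorem Hyp.self_neg (x : Hyp n) : mink x.1 x.1 < 0 := by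
  rw [x.2.1]; norm_num

theorem Hyp.mink_neg (x y : Hyp n) : mink x.1 y.1 < 0 :=
  mink_neg_of_forward x.self_neg x.2.2 y.self_neg y.2.2

/-- The reversed Cauchy–Schwarz inequality on `H^n`. -/
theorem Hyp.mink_le (x y : Hyp n) : mink x.1 y.1 ≤ -1 := by
  have hxx := x.2.1
  have hyy := y.2.1
  have h := mink_self_nonneg_of_orthogonal (u := y.1 + mink x.1 y.1 • x.1) x.self_neg (by
    rw [mink_add_right, mink_smul_right, hxx]; ring)
  simp only [mink_add_left, mink_add_right, mink_smul_left, mink_smul_right,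
    mink_comm y.1 x.1, hxx, hyy] at h
  have := x.mink_neg y
  nlinarith

/-- The hyperbolic reflection, as a linear map. -/
noncomputable def minkReflectLin (e : Fin (n + 1) → ℝ) :
    (Fin (n + 1) → ℝ) →ₗ[ℝ] (Fin (n + 1) → ℝ) :=
  LinearMap.id - (2 : ℝ) • ((minkForm n).flip e).smulRight e

theorem minkReflectLin_apply (e x : Fin (n + 1) → ℝ) :
    minkReflectLin e x = x - (2 * mink x e) • e := by
  simp [minkReflectLin, minkForm_apply, smul_smul]

end Minkowski

/-! ### Walls of acute-angled polyhedra -/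

section Acute

variable {n : ℕ}

open Filter Topology in
/-- A vector of an open subset of the hyperplane `e^⊥`, given by finitely many strict linear
inequalities inside the forward light cone, can be moved off any finite family of hyperplanes
whose normals are not multiples of `e`. -/
theorem exists_generic_forward {ι κ : Type*} [Finite ι] [Finite κ] {e : Fin (n + 1) → ℝ}
    (he : mink e e = 1) (y : Fin (n + 1) → ℝ) (hy : mink y y < 0) (hy0 : 0 < y 0)
    (hye : mink y e = 0) (f : ι → Fin (n + 1) → ℝ) (hf : ∀ i, mink y (f i) < 0)
    (c : κ → Fin (n + 1) → ℝ) (hc : ∀ k, ∀ μ : ℝ, c k ≠ μ • e) :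
    ∃ z : Fin (n + 1) → ℝ, mink z z < 0 ∧ 0 < z 0 ∧ mink z e = 0 ∧ (∀ i, mink z (f i) < 0) ∧
      ∀ k, mink z (c k) ≠ 0 := by
  have hex : ∀ k, ∃ w, (minkForm n (c k - mink (c k) e • e)) w ≠ 0 := by
    intro k
    by_contra! h
    exact hc k (mink (c k) e) (sub_eq_zero.mp (eq_zero_of_mink_eq_zero h))
  obtain ⟨w, hw⟩ := Module.Dual.exists_forall_ne_zero_of_forall_exists _ hex
  set v := w - mink w e • e with hv
  have hvc : ∀ k, mink v (c k) ≠ 0 := by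
    intro k
    have h := hw k
    rw [minkForm_apply, mink_sub_left, mink_smul_left, mink_comm e w, mink_comm (c k) w] at h
    rw [hv, mink_sub_left, mink_smul_left, mink_comm e (c k)]
    intro h'
    apply h
    linarith
  have hve : mink v e = 0 := by
    rw [hv, mink_sub_left, mink_smul_left, he]; ring
  have hcont : Continuous fun t : ℝ => y + t • v := by fun_prop
  have hlim : ∀ g : (Fin (n + 1) → ℝ) → ℝ, Continuous g →
      Tendsto (fun t : ℝ => g (y + t • v)) (𝓝[>] 0) (𝓝 (g y)) := by
    intro g hg
    have h := ((hg.comp hcont).tendsto 0)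
    simp only [Function.comp_apply, zero_smul, add_zero] at h
    exact h.mono_left nhdsWithin_le_nhds
  have h1 := (hlim (fun z => mink z z) (by unfold mink; fun_prop)).eventually_lt_const hy
  have h2 := (hlim (fun z => z 0) (continuous_apply 0)).eventually_const_lt hy0
  have h3 : ∀ᶠ t : ℝ in 𝓝[>] 0, ∀ i, mink (y + t • v) (f i) < 0 :=
    eventually_all.mpr fun i =>
      (hlim (fun z => mink z (f i)) (continuous_mink_left _)).eventually_lt_const (hf i)
  have h4 : ∀ᶠ t : ℝ in 𝓝[>] 0, ∀ k, mink (y + t • v) (c k) ≠ 0 := by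
    refine eventually_all.mpr fun k => ?_
    by_cases hk : mink y (c k) = 0
    · filter_upwards [self_mem_nhdsWithin] with t ht
      rw [mink_add_left, mink_smul_left, hk, zero_add]
      exact mul_ne_zero (ne_of_gt ht) (hvc k)
    · exact (hlim (fun z => mink z (c k)) (continuous_mink_left _)).eventually_ne hk
  obtain ⟨t, h1, h2, h3, h4⟩ := (h1.and (h2.and (h3.and h4))).exists
  refine ⟨y + t • v, h1, h2, ?_, h3, h4⟩
  rw [mink_add_left, mink_smul_left, hye, hve]; ring

namespace HypPolyhedron

variable (Q : HypPolyhedron n)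

/-- Adjacency can be tested on vectors of the forward light cone. -/
theorem adjacent_of_forward {i j : Fin Q.numWalls} (hij : i ≠ j) {z : Fin (n + 1) → ℝ}
    (hz : mink z z < 0) (hz0 : 0 < z 0) (hi : mink z (Q.normal i) = 0)
    (hj : mink z (Q.normal j) = 0)
    (hk : ∀ k, k ≠ i → k ≠ j → mink z (Q.normal k) < 0) : Q.Adjacent i j := by
  obtain ⟨x, c, hc, hx⟩ := exists_hyp_smul hz hz0
  refine ⟨hij, x, ?_, ?_, fun k hki hkj => ?_⟩
  · rw [hx, mink_smul_left, hi, mul_zero]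
  · rw [hx, mink_smul_left, hj, mul_zero]
  · rw [hx, mink_smul_left]
    exact mul_neg_of_pos_of_neg hc (hk k hki hkj)

/-- Inside its hyperplane, a wall is cut out by the adjacent walls: a generic segment from an
interior point of the wall leaves the wall through a face of codimension two. -/
theorem mink_nonpos_of_adjacent {i : Fin Q.numWalls} {x : Fin (n + 1) → ℝ}
    (hx : mink x x < 0) (hx0 : 0 < x 0) (hxi : mink x (Q.normal i) = 0)
    (hadj : ∀ k, Q.Adjacent i k → mink x (Q.normal k) ≤ 0) (l : Fin Q.numWalls) :
    mink x (Q.normal l) ≤ 0 := by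
  classical
  by_contra! hl
  obtain ⟨y, hyi, hyk⟩ := Q.wall_codim_one i
  have hmem : ∀ k, 0 < mink x (Q.normal k) → k ≠ i := by
    rintro k hk rfl
    exact absurd hxi hk.ne'
  -- The traces on the `i`-th hyperplane of two walls that `x` violates are different.
  have htrace : ∀ p : {p : Fin Q.numWalls × Fin Q.numWalls //
      p.1 ≠ p.2 ∧ 0 < mink x (Q.normal p.1) ∧ 0 < mink x (Q.normal p.2)}, ∀ μ : ℝ,
      mink x (Q.normal p.1.1) • Q.normal p.1.2 - mink x (Q.normal p.1.2) • Q.normal p.1.1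
        ≠ μ • Q.normal i := by
    rintro ⟨⟨k, m⟩, hkm, hk, hm⟩ μ h
    simp only at hkm hk hm h
    obtain ⟨yk, hyk0, hyk⟩ := Q.wall_codim_one k
    obtain ⟨ym, hym0, hym⟩ := Q.wall_codim_one m
    have e1 := congrArg (mink yk.1) h
    have e2 := congrArg (mink ym.1) h
    simp only [mink_sub_right, mink_smul_right, hyk0, hym0] at e1 e2
    have a1 := hyk m hkm.symm
    have a2 := hyk i (hmem k hk).symm
    have b1 := hym k hkm
    have b2 := hym i (hmem m hm).symm
    rcases le_or_gt 0 μ with hμ | hμ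
    · nlinarith [mul_pos hm (neg_pos.mpr b1), mul_nonneg hμ (neg_nonneg.mpr b2.le)]
    · nlinarith [mul_pos hk (neg_pos.mpr a1), mul_pos (neg_pos.mpr hμ) (neg_pos.mpr a2)]
  obtain ⟨z, hz, hz0, hzi, hzk, hzc⟩ := exists_generic_forward (Q.normal_unit i) y.1 y.self_neg
    y.2.2 hyi (fun k : {k // k ≠ i} => Q.normal k) (fun k => hyk k k.2) _ htrace
  -- The last wall crossed on the way from `x` to `z`.
  obtain ⟨m, hm, hmax⟩ := Finset.exists_max_image
    (Finset.univ.filter fun k => 0 < mink x (Q.normal k))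
    (fun k => mink x (Q.normal k) / -mink z (Q.normal k)) ⟨l, by simpa using hl⟩
  simp only [Finset.mem_filter, Finset.mem_univ, true_and] at hm hmax
  have hzneg : ∀ k, k ≠ i → mink z (Q.normal k) < 0 := fun k hk => hzk ⟨k, hk⟩
  set R := mink x (Q.normal m) / -mink z (Q.normal m) with hR
  have hzm := hzneg m (hmem m hm)
  have hRpos : 0 < R := div_pos hm (neg_pos.mpr hzm)
  have hRm : R * mink z (Q.normal m) = -mink x (Q.normal m) := by
    have h := div_mul_cancel₀ (mink x (Q.normal m)) (neg_ne_zero.mpr hzm.ne)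
    rw [← hR] at h
    linarith
  have hadjm : Q.Adjacent i m := by
    refine Q.adjacent_of_forward (hmem m hm).symm (z := x + R • z) ?_ ?_ ?_ ?_ ?_
    · have := mink_neg_of_forward hx hx0 hz hz0
      simp only [mink_add_left, mink_add_right, mink_smul_left, mink_smul_right, mink_comm z x]
      nlinarith [mul_pos hRpos hRpos, mul_pos hRpos (neg_pos.mpr this)]
    · simpa using add_pos hx0 (mul_pos hRpos hz0)
    · rw [mink_add_left, mink_smul_left, hxi, hzi]; ring
    · rw [mink_add_left, mink_smul_left, hRm]; ring
    · intro k hki hkm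
      rw [mink_add_left, mink_smul_left]
      have hzk := hzneg k hki
      rcases le_or_gt (mink x (Q.normal k)) 0 with hk | hk
      · nlinarith [mul_pos hRpos (neg_pos.mpr hzk)]
      · have h1 := hmax k hk
        rw [div_le_iff₀ (neg_pos.mpr hzk)] at h1
        rcases h1.lt_or_eq with h2 | h2
        · linarith
        · exfalso
          apply hzc ⟨(k, m), hkm, hk, hm⟩
          simp only [mink_sub_right, mink_smul_right]
          rw [h2]
          linear_combination (-mink z (Q.normal k)) * hRm
  exact absurd (hadj m hadjm) (not_le.mpr hm)

/-- If adjacent walls make non-obtuse angles, then the outward normals of any two walls have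
nonpositive product. Projecting to the hyperplane of a wall preserves the inequalities of the
adjacent walls, hence maps the polyhedron to itself; but the projection of a point of a wall `j`
with `⟨e_i, e_j⟩ > 0` would leave the polyhedron. -/
theorem mink_normal_nonpos
    (hacute : ∀ i j, Q.Adjacent i j → mink (Q.normal i) (Q.normal j) ≤ 0)
    {i j : Fin Q.numWalls} (hij : i ≠ j) : mink (Q.normal i) (Q.normal j) ≤ 0 := by
  obtain ⟨y, hyj, hyk⟩ := Q.wall_codim_one j
  have hyi := hyk i hij
  have hy := y.2.1
  have key := Q.mink_nonpos_of_adjacent (i := i) (x := y.1 - mink y.1 (Q.normal i) • Q.normal i)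
    ?_ ?_ ?_ ?_ j
  · rw [mink_sub_left, mink_smul_left, hyj] at key
    nlinarith
  · simp only [mink_sub_left, mink_sub_right, mink_smul_left, mink_smul_right, Q.normal_unit,
      hy, mink_comm (Q.normal i) y.1]
    nlinarith [mul_self_nonneg (mink y.1 (Q.normal i))]
  · refine forward_of_mink_neg y.self_neg y.2.2 ?_ ?_
    · simp only [mink_sub_left, mink_sub_right, mink_smul_left, mink_smul_right, Q.normal_unit,
        hy, mink_comm (Q.normal i) y.1]
      nlinarith [mul_self_nonneg (mink y.1 (Q.normal i))]
    · rw [mink_sub_right, mink_smul_right, hy]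
      nlinarith [mul_self_nonneg (mink y.1 (Q.normal i))]
  · rw [mink_sub_left, mink_smul_left, Q.normal_unit]; ring
  · intro k hk
    rw [mink_sub_left, mink_smul_left]
    have h1 := hacute i k hk
    have h2 : mink y.1 (Q.normal k) ≤ 0 := by
      by_cases hkj : k = j
      · rw [hkj, hyj]
      · exact (hyk k hkj).le
    nlinarith

/-- In an acute-angled polyhedron, walls whose hyperplanes meet are adjacent: an interior point
projects to a relative interior point of the face of codimension two. -/
theorem adjacent_of_mink_gt
    (hacute : ∀ i j, Q.Adjacent i j → mink (Q.normal i) (Q.normal j) ≤ 0)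
    {i j : Fin Q.numWalls} (hij : i ≠ j) (hlt : -1 < mink (Q.normal i) (Q.normal j)) :
    Q.Adjacent i j := by
  obtain ⟨x, hx⟩ := Q.interior_nonempty
  have hg := Q.mink_normal_nonpos hacute hij
  set g := mink (Q.normal i) (Q.normal j) with hgdef
  have hD : 0 < 1 - g ^ 2 := by nlinarith
  have hp := hx i
  have hq := hx j
  set p := mink x.1 (Q.normal i) with hpdef
  set q := mink x.1 (Q.normal j) with hqdef
  -- The coefficients solve the two linear equations for the projection.
  set a := (g * q - p) / (1 - g ^ 2) with ha
  set b := (g * p - q) / (1 - g ^ 2) with hb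
  have hapos : 0 < a := div_pos (by nlinarith) hD
  have hbpos : 0 < b := div_pos (by nlinarith) hD
  have h1 : p + a + b * g = 0 := by
    rw [ha, hb]; field_simp; ring
  have h2 : q + a * g + b = 0 := by
    rw [ha, hb]; field_simp; ring
  have hx1 := x.2.1
  have hself : mink (x.1 + a • Q.normal i + b • Q.normal j)
      (x.1 + a • Q.normal i + b • Q.normal j) < 0 := by
    simp only [mink_add_left, mink_add_right, mink_smul_left, mink_smul_right, Q.normal_unit,
      hx1, mink_comm (Q.normal i) x.1, mink_comm (Q.normal j) x.1, mink_comm (Q.normal j)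
      (Q.normal i), ← hgdef, ← hpdef, ← hqdef]
    nlinarith [mul_pos hapos (neg_pos.mpr hp), mul_pos hbpos (neg_pos.mpr hq)]
  refine Q.adjacent_of_forward hij hself ?_ ?_ ?_ ?_
  · refine forward_of_mink_neg x.self_neg x.2.2 hself ?_
    rw [mink_add_right, mink_add_right, mink_smul_right, mink_smul_right, hx1]
    nlinarith
  · simp only [mink_add_left, mink_smul_left, Q.normal_unit, mink_comm (Q.normal j) (Q.normal i)]
    linarith
  · simp only [mink_add_left, mink_smul_left, Q.normal_unit]
    linarith
  · intro k hki hkj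
    simp only [mink_add_left, mink_smul_left]
    have k1 := Q.mink_normal_nonpos hacute hki.symm
    have k2 := Q.mink_normal_nonpos hacute hkj.symm
    nlinarith [hx k]

end HypPolyhedron

end Acute

/-! ### Isometries of hyperbolic space are linear -/

section Linear

variable {n : ℕ}

/-- The points of `H^n` span the ambient space: every vector is the sum of a point of `H^n` and
a multiple of another one. -/
theorem exists_eq_hyp_add_smul (v : Fin (n + 1) → ℝ) :
    ∃ (x y : Hyp n) (c : ℝ), v = x.1 + c • y.1 := by
  refine ⟨hypLift fun i => v i.succ, hypLift 0, v 0 - (hypLift fun i => v i.succ).1 0, ?_⟩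
  funext k
  refine Fin.cases ?_ (fun i => ?_) k
  · simp [hypLift]
  · simp [hypLift]

theorem eq_zero_of_mink_hyp_eq_zero {v : Fin (n + 1) → ℝ} (h : ∀ x : Hyp n, mink v x.1 = 0) :
    v = 0 := by
  refine eq_zero_of_mink_eq_zero fun y => ?_
  obtain ⟨a, b, c, rfl⟩ := exists_eq_hyp_add_smul y
  rw [mink_add_right, mink_smul_right, h, h, mul_zero, add_zero]

theorem linearMap_ext_hyp {E : Type*} [AddCommGroup E] [Module ℝ E]
    {f g : (Fin (n + 1) → ℝ) →ₗ[ℝ] E} (h : ∀ x : Hyp n, f x.1 = g x.1) : f = g := by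
  refine LinearMap.ext fun v => ?_
  obtain ⟨a, b, c, rfl⟩ := exists_eq_hyp_add_smul v
  simp only [map_add, map_smul, h]

theorem mink_isom_apply (g : HypIsom n) (x y : Hyp n) :
    mink (g.1 x).1 (g.1 y).1 = mink x.1 y.1 := by
  have h : Real.arcosh (-(mink (g.1 x).1 (g.1 y).1)) = Real.arcosh (-(mink x.1 y.1)) := g.2 x y
  have h1 := (g.1 x).mink_le (g.1 y)
  have h2 := x.mink_le y
  have := Real.arcosh_injOn (by simp only [Set.mem_Ici]; linarith)
    (by simp only [Set.mem_Ici]; linarith) h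
  linarith

theorem exists_linear_of_isom (g : HypIsom n) :
    ∃ L : (Fin (n + 1) → ℝ) →ₗ[ℝ] (Fin (n + 1) → ℝ), ∀ x : Hyp n, L x.1 = (g.1 x).1 := by
  set T := Finsupp.linearCombination ℝ (fun x : Hyp n => x.1) with hT
  set Tg := Finsupp.linearCombination ℝ (fun x : Hyp n => (g.1 x).1) with hTg
  have hsurj : LinearMap.range T = ⊤ := by
    refine LinearMap.range_eq_top.mpr fun v => ?_
    obtain ⟨a, b, c, rfl⟩ := exists_eq_hyp_add_smul v
    refine ⟨Finsupp.single a 1 + Finsupp.single b c, ?_⟩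
    simp [hT]
  have hker : ∀ f, T f = 0 → Tg f = 0 := by
    intro f hf
    refine eq_zero_of_mink_hyp_eq_zero fun y => ?_
    obtain ⟨z, rfl⟩ := g.1.surjective y
    have h : mink (Tg f) (g.1 z).1 = mink (T f) z.1 := by
      simp only [hTg, hT, Finsupp.linearCombination_apply, Finsupp.sum, mink_sum_left,
        mink_smul_left, mink_isom_apply]
    rw [h, hf, mink_zero_left]
  obtain ⟨S, hS⟩ := T.exists_rightInverse_of_surjective hsurj
  refine ⟨Tg ∘ₗ S, fun x => ?_⟩
  have h1 : T (S x.1 - Finsupp.single x 1) = 0 := by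
    rw [map_sub]
    have := LinearMap.congr_fun hS x.1
    simp only [LinearMap.comp_apply, LinearMap.id_apply] at this
    rw [this]
    simp [hT]
  have h2 := hker _ h1
  rw [map_sub, sub_eq_zero] at h2
  rw [LinearMap.comp_apply, h2]
  simp [hTg]

/-- The linear extension of the isometries of `H^n` to the ambient Minkowski space. -/
noncomputable def hypLin (n : ℕ) : HypIsom n →* Module.End ℝ (Fin (n + 1) → ℝ) where
  toFun g := (exists_linear_of_isom g).choose
  map_one' := linearMap_ext_hyp fun x => (exists_linear_of_isom 1).choose_spec x
  map_mul' g h := linearMap_ext_hyp fun x => by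
    rw [Module.End.mul_apply, (exists_linear_of_isom h).choose_spec, (exists_linear_of_isom g).choose_spec,
      (exists_linear_of_isom (g * h)).choose_spec]
    rfl

theorem hypLin_coe (g : HypIsom n) (x : Hyp n) : hypLin n g x.1 = (g.1 x).1 :=
  (exists_linear_of_isom g).choose_spec x

theorem mink_hypLin (g : HypIsom n) (u v : Fin (n + 1) → ℝ) :
    mink (hypLin n g u) (hypLin n g v) = mink u v := by
  obtain ⟨a, b, c, rfl⟩ := exists_eq_hyp_add_smul u
  obtain ⟨a', b', c', rfl⟩ := exists_eq_hyp_add_smul v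
  simp only [map_add, map_smul, hypLin_coe, mink_add_left, mink_add_right, mink_smul_left,
    mink_smul_right, mink_isom_apply]

theorem hypLin_injective : Function.Injective (hypLin n) := by
  intro g h hgh
  refine Subtype.ext (Equiv.ext fun x => Subtype.ext ?_)
  rw [← hypLin_coe, ← hypLin_coe, hgh]

theorem hypLin_inv_apply (g : HypIsom n) (v : Fin (n + 1) → ℝ) :
    hypLin n g⁻¹ (hypLin n g v) = v := by
  rw [← Module.End.mul_apply, ← map_mul, inv_mul_cancel, map_one, Module.End.one_apply]

theorem hypLin_apply_inv (g : HypIsom n) (v : Fin (n + 1) → ℝ) :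
    hypLin n g (hypLin n g⁻¹ v) = v := by
  rw [← Module.End.mul_apply, ← map_mul, mul_inv_cancel, map_one, Module.End.one_apply]

theorem mink_hypLin_left (g : HypIsom n) (u v : Fin (n + 1) → ℝ) :
    mink (hypLin n g u) v = mink u (hypLin n g⁻¹ v) := by
  rw [← mink_hypLin g u, hypLin_apply_inv]

theorem hypLin_reflection {e : Fin (n + 1) → ℝ} (he : mink e e = 1) (v : Fin (n + 1) → ℝ) :
    hypLin n (hypReflection e he) v = v - (2 * mink v e) • e := by
  have h : hypLin n (hypReflection e he) = minkReflectLin e :=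
    linearMap_ext_hyp fun x => by rw [hypLin_coe, minkReflectLin_apply]; rfl
  rw [h, minkReflectLin_apply]

theorem hypReflection_congr {e e' : Fin (n + 1) → ℝ} (he : mink e e = 1) (he' : mink e' e' = 1)
    (h : e = e') : hypReflection e he = hypReflection e' he' := by
  subst h; rfl

theorem hypReflection_mul_self {e : Fin (n + 1) → ℝ} (he : mink e e = 1) :
    hypReflection e he * hypReflection e he = 1 :=
  Subtype.ext (Equiv.ext fun x => Subtype.ext (minkReflect_invol e he x.1))

/-- Conjugates of reflections are reflections. -/
theorem conj_hypReflection (g : HypIsom n) {e : Fin (n + 1) → ℝ} (he : mink e e = 1) :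
    g * hypReflection e he * g⁻¹
      = hypReflection (hypLin n g e) (by rw [mink_hypLin, he]) := by
  refine hypLin_injective (LinearMap.ext fun v => ?_)
  rw [map_mul, map_mul, Module.End.mul_apply, Module.End.mul_apply, hypLin_reflection,
    hypLin_reflection, map_sub, map_smul, hypLin_apply_inv, mink_hypLin_left, inv_inv]

theorem hypReflection_neg {e : Fin (n + 1) → ℝ} (he : mink e e = 1) (he' : mink (-e) (-e) = 1) :
    hypReflection (-e) he' = hypReflection e he := by
  refine hypLin_injective (LinearMap.ext fun v => ?_)
  rw [hypLin_reflection, hypLin_reflection, mink_neg_right]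
  simp

/-- A reflection determines its unit normal up to sign. -/
theorem eq_or_eq_neg_of_hypReflection_eq {e e' : Fin (n + 1) → ℝ} {he : mink e e = 1}
    {he' : mink e' e' = 1} (h : hypReflection e he = hypReflection e' he') :
    e' = e ∨ e' = -e := by
  have h1 := congrArg (fun g => hypLin n g e) h
  simp only [hypLin_reflection, he] at h1
  have h2 : e = mink e e' • e' := by
    have h3 : (2 : ℝ) • e = (2 : ℝ) • (mink e e' • e') := by
      rw [smul_smul]
      simpa using h1
    exact smul_right_injective _ (two_ne_zero) h3
  have h3 : mink e e' * mink e e' = 1 := by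
    have h4 := he
    rw [h2] at h4
    simp only [mink_smul_left, mink_smul_right, he'] at h4
    linarith
  rcases mul_self_eq_one_iff.mp h3 with h4 | h4
  · left; rw [h4, one_smul] at h2; exact h2.symm
  · right; rw [h4, neg_smul, one_smul] at h2; rw [h2, neg_neg]

theorem hypReflection_ne_one {e : Fin (n + 1) → ℝ} (he : mink e e = 1) :
    hypReflection e he ≠ 1 := by
  intro h
  have h1 := congrArg (fun g => hypLin n g e) h
  simp only [hypLin_reflection, he, map_one, Module.End.one_apply] at h1
  have h2 : (2 : ℝ) • e = 0 := by simpa using h1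
  have h3 : e = 0 := (smul_eq_zero.mp h2).resolve_left two_ne_zero
  rw [h3, mink_zero_left] at he
  exact zero_ne_one he

end Linear

/-! ### Linear Coxeter groups generated by hyperbolic reflections -/

section DihedralReflections

variable {n : ℕ}

/-- If unit vectors `e`, `f` satisfy `⟨e, f⟩ = -cos (π / m)`, then the product of the two
reflections is a rotation of angle `2π / m`. -/
theorem hypReflection_mul_pow_eq_one {e f : Fin (n + 1) → ℝ} (he : mink e e = 1)
    (hf : mink f f = 1) {m : ℕ} (hm : 2 ≤ m) (hef : mink e f = -Real.cos (Real.pi / m)) :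
    (hypReflection e he * hypReflection f hf) ^ m = 1 := by
  set θ := Real.pi / m with hθ
  have hm0 : (0 : ℝ) < m := by exact_mod_cast (by omega : 0 < m)
  have hθpos : 0 < θ := div_pos Real.pi_pos hm0
  have hθlt : θ < Real.pi := by
    rw [hθ, div_lt_iff₀ hm0]
    have : (2 : ℝ) ≤ m := by exact_mod_cast hm
    nlinarith [Real.pi_pos]
  have hs : 0 < Real.sin θ := Real.sin_pos_of_pos_of_lt_pi hθpos hθlt
  have hsc := Real.sin_sq_add_cos_sq θ
  have hfe : mink f e = -Real.cos θ := by rw [mink_comm, hef]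
  set g := hypReflection e he * hypReflection f hf with hg
  set A := hypLin n g with hA
  have hAv : ∀ v, A v = v - (2 * mink v f) • f - (2 * mink (v - (2 * mink v f) • f) e) • e := by
    intro v
    rw [hA, hg, map_mul, Module.End.mul_apply, hypLin_reflection, hypLin_reflection]
  have hAe : A e = (4 * Real.cos θ ^ 2 - 1) • e + (2 * Real.cos θ) • f := by
    rw [hAv]
    simp only [mink_sub_left, mink_smul_left, hef, he, hfe]
    module
  have hAf : A f = (-(2 * Real.cos θ)) • e - f := by
    rw [hAv]
    simp only [mink_sub_left, mink_smul_left, hf, hfe]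
    module
  have hpow : ∀ k : ℕ,
      Real.sin θ • (A ^ k) e = Real.sin (2 * k * θ + θ) • e + Real.sin (2 * k * θ) • f ∧
      Real.sin θ • (A ^ k) f = (-Real.sin (2 * k * θ)) • e - Real.sin (2 * k * θ - θ) • f := by
    intro k
    induction k with
    | zero => simp
    | succ k ih =>
      obtain ⟨h1, h2⟩ := ih
      have e1 : (2 * ((k + 1 : ℕ) : ℝ) * θ) = 2 * k * θ + θ + θ := by push_cast; ring
      have t1 : Real.sin (2 * k * θ + θ + θ) =
          2 * Real.cos θ * Real.sin (2 * k * θ + θ) - Real.sin (2 * k * θ) := by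
        simp only [Real.sin_add, Real.cos_add]
        linear_combination (-Real.sin (2 * k * θ)) * hsc
      have t2 : Real.sin (2 * k * θ + θ + θ + θ) =
          2 * Real.cos θ * Real.sin (2 * k * θ + θ + θ) - Real.sin (2 * k * θ + θ) := by
        simp only [Real.sin_add, Real.cos_add]
        linear_combination (-Real.sin (2 * k * θ) * Real.cos θ - Real.cos (2 * k * θ)
          * Real.sin θ) * hsc
      have t3 : Real.sin (2 * k * θ - θ) =
          2 * Real.cos θ * Real.sin (2 * k * θ) - Real.sin (2 * k * θ + θ) := by
        simp only [Real.sin_add, Real.sin_sub]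
        ring
      rw [e1, add_sub_cancel_right, t2, t1, pow_succ, Module.End.mul_apply, Module.End.mul_apply,
        hAe, hAf]
      constructor
      · rw [map_add, map_smul, map_smul, smul_add, smul_comm _ _ ((A ^ k) e),
          smul_comm _ _ ((A ^ k) f), h1, h2, t3]
        module
      · rw [map_sub, map_smul, smul_sub, smul_comm _ _ ((A ^ k) e), h1, h2, t3]
        module
  have hmθ : (m : ℝ) * θ = Real.pi := by rw [hθ]; field_simp
  obtain ⟨h1, h2⟩ := hpow m
  have e2 : 2 * (m : ℝ) * θ = 2 * Real.pi := by rw [mul_assoc, hmθ]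
  rw [e2, Real.sin_two_pi, add_comm (2 * Real.pi) θ, Real.sin_add_two_pi, zero_smul,
    add_zero] at h1
  rw [e2, Real.sin_two_pi, Real.sin_sub, Real.sin_two_pi, Real.cos_two_pi] at h2
  have hme : (A ^ m) e = e := smul_right_injective _ hs.ne' h1
  have hmf : (A ^ m) f = f := smul_right_injective _ hs.ne' (by simpa using h2)
  -- The product fixes the orthogonal complement of the plane spanned by `e` and `f`.
  have hperp : ∀ v, mink v e = 0 → mink v f = 0 → (A ^ m) v = v := by
    intro v hve hvf
    have hAv' : A v = v := by rw [hAv, hvf]; simp [hve]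
    clear hpow h1 h2 e2 hme hmf hmθ
    generalize m = k
    induction k with
    | zero => simp
    | succ k ih => rw [pow_succ, Module.End.mul_apply, hAv', ih]
  refine hypLin_injective (LinearMap.ext fun v => ?_)
  rw [map_pow, map_one, Module.End.one_apply]
  set a := (mink v e + Real.cos θ * mink v f) / Real.sin θ ^ 2 with ha
  set b := (mink v f + Real.cos θ * mink v e) / Real.sin θ ^ 2 with hb
  have ha' : a * Real.sin θ ^ 2 = mink v e + Real.cos θ * mink v f := by
    rw [ha]; field_simp
  have hb' : b * Real.sin θ ^ 2 = mink v f + Real.cos θ * mink v e := by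
    rw [hb]; field_simp
  have hs2 : Real.sin θ ^ 2 ≠ 0 := (pow_pos hs 2).ne'
  have hv0 := hperp (v - a • e - b • f)
    (by
      simp only [mink_sub_left, mink_smul_left, he, hfe]
      apply mul_left_cancel₀ hs2
      linear_combination -ha' + Real.cos θ * hb' + mink v e * hsc)
    (by
      simp only [mink_sub_left, mink_smul_left, hf, hef]
      apply mul_left_cancel₀ hs2
      linear_combination -hb' + Real.cos θ * ha' + mink v f * hsc)
  rw [map_sub, map_sub, map_smul, map_smul, hme, hmf] at hv0
  rw [← hA]
  simpa using hv0

end DihedralReflections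

/-- Finitely many mirrors in `H^n`, given by outward unit normals `e i` and a point `base` on the
negative sides of all of them, such that any two of the mirrors `i ≠ j` either bound a dihedral
angle `π / M i j`, or do not meet in `H^n` and bound a common region, in which case
`M i j = 0` (Mathlib's encoding of an infinite label). -/
structure MirrorSystem (n : ℕ) (B : Type*) where
  /-- The Coxeter matrix. -/
  M : CoxeterMatrix B
  /-- The outward unit normals. -/
  e : B → (Fin (n + 1) → ℝ)
  unit : ∀ i, mink (e i) (e i) = 1
  /-- An interior point of the chamber. -/
  base : Hyp n
  base_neg : ∀ i, mink base.1 (e i) < 0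
  gram : ∀ i j, i ≠ j → (M i j ≠ 0 ∧ mink (e i) (e j) = -Real.cos (Real.pi / M i j)) ∨
    (M i j = 0 ∧ mink (e i) (e j) ≤ -1)

namespace MirrorSystem

variable {n : ℕ} {B : Type*} (S : MirrorSystem n B)

/-- The reflection in the `i`-th mirror. -/
noncomputable def refl (i : B) : HypIsom n := hypReflection (S.e i) (S.unit i)

theorem two_le {i j : B} (hij : i ≠ j) (h : S.M i j ≠ 0) : 2 ≤ S.M i j := by
  have := S.M.off_diagonal i j hij
  omega

theorem mink_e_nonpos {i j : B} (hij : i ≠ j) : mink (S.e i) (S.e j) ≤ 0 := by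
  rcases S.gram i j hij with ⟨h0, h⟩ | ⟨_, h⟩
  · rw [h, neg_nonpos]
    have h2 : (2 : ℝ) ≤ S.M i j := by exact_mod_cast S.two_le hij h0
    refine Real.cos_nonneg_of_neg_pi_div_two_le_of_le ?_ ?_
    · have : 0 ≤ Real.pi / S.M i j := div_nonneg Real.pi_pos.le (by linarith)
      linarith [Real.pi_pos]
    · exact div_le_div_of_nonneg_left Real.pi_pos.le two_pos h2
  · linarith

theorem isLiftable_refl : S.M.IsLiftable S.refl := by
  intro i j
  by_cases hij : i = j
  · subst hij
    rw [S.M.diagonal, pow_one]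
    exact hypReflection_mul_self _
  · rcases S.gram i j hij with ⟨h0, h⟩ | ⟨h0, _⟩
    · exact hypReflection_mul_pow_eq_one _ _ (S.two_le hij h0) h
    · rw [h0, pow_zero]

/-- The Coxeter system of the abstract group of `S`. -/
def cs : CoxeterSystem S.M S.M.Group := S.M.toCoxeterSystem

/-- The homomorphism from the abstract Coxeter group to the isometry group of `H^n` that sends
the simple generators to the reflections in the mirrors. -/
noncomputable def rho : S.M.Group →* HypIsom n := S.cs.lift ⟨S.refl, S.isLiftable_refl⟩

theorem rho_simple (i : B) : S.rho (S.cs.simple i) = S.refl i :=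
  S.cs.lift_apply_simple S.isLiftable_refl i

/-- The linear action of the abstract Coxeter group on the ambient Minkowski space. -/
noncomputable def lin : S.M.Group →* Module.End ℝ (Fin (n + 1) → ℝ) := (hypLin n).comp S.rho

theorem lin_apply (w : S.M.Group) (v : Fin (n + 1) → ℝ) : S.lin w v = hypLin n (S.rho w) v := rfl

theorem lin_simple (i : B) (v : Fin (n + 1) → ℝ) :
    S.lin (S.cs.simple i) v = v - (2 * mink v (S.e i)) • S.e i := by
  rw [lin_apply, rho_simple, refl, hypLin_reflection]

theorem lin_mul (w w' : S.M.Group) (v : Fin (n + 1) → ℝ) :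
    S.lin (w * w') v = S.lin w (S.lin w' v) := by
  rw [map_mul, Module.End.mul_apply]

theorem mink_lin (w : S.M.Group) (u v : Fin (n + 1) → ℝ) :
    mink (S.lin w u) (S.lin w v) = mink u v := mink_hypLin _ _ _

theorem mink_lin_left (w : S.M.Group) (u v : Fin (n + 1) → ℝ) :
    mink (S.lin w u) v = mink u (S.lin w⁻¹ v) := by
  rw [lin_apply, lin_apply, mink_hypLin_left, map_inv S.rho]

/-- The closed chamber, as a cone in the ambient space. -/
def chamber : Set (Fin (n + 1) → ℝ) := {q | ∀ i, mink q (S.e i) ≤ 0}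

theorem base_mem_chamber : S.base.1 ∈ S.chamber := fun i => (S.base_neg i).le

/-- The coefficients of the roots of a dihedral reflection group with respect to its two simple
roots: the values at `κ` of the Chebyshev polynomials of the second kind, shifted by one. -/
def dihedralCoeff (κ : ℝ) : ℕ → ℝ
  | 0 => 0
  | 1 => 1
  | k + 2 => 2 * κ * dihedralCoeff κ (k + 1) - dihedralCoeff κ k

theorem dihedralCoeff_add_two (κ : ℝ) (k : ℕ) :
    dihedralCoeff κ (k + 2) = 2 * κ * dihedralCoeff κ (k + 1) - dihedralCoeff κ k := rfl

theorem dihedralCoeff_cos (θ : ℝ) (k : ℕ) :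
    dihedralCoeff (Real.cos θ) k * Real.sin θ = Real.sin (k * θ) ∧
    dihedralCoeff (Real.cos θ) (k + 1) * Real.sin θ = Real.sin (k * θ + θ) := by
  induction k with
  | zero => simp [dihedralCoeff]
  | succ k ih =>
    obtain ⟨h1, h2⟩ := ih
    have e1 : ((k + 1 : ℕ) : ℝ) * θ = k * θ + θ := by push_cast; ring
    rw [e1]
    refine ⟨h2, ?_⟩
    have t1 : Real.sin (k * θ + θ + θ) =
        2 * Real.cos θ * Real.sin (k * θ + θ) - Real.sin (k * θ) := by
      simp only [Real.sin_add, Real.cos_add]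
      linear_combination (-Real.sin (k * θ)) * Real.sin_sq_add_cos_sq θ
    rw [t1, ← h1, ← h2, dihedralCoeff_add_two]
    ring

theorem dihedralCoeff_of_one_le {κ : ℝ} (hκ : 1 ≤ κ) (k : ℕ) :
    0 ≤ dihedralCoeff κ k ∧ dihedralCoeff κ k ≤ dihedralCoeff κ (k + 1) := by
  induction k with
  | zero => simp [dihedralCoeff]
  | succ k ih =>
    obtain ⟨h1, h2⟩ := ih
    refine ⟨h1.trans h2, ?_⟩
    rw [dihedralCoeff_add_two]
    nlinarith

theorem dihedralCoeff_nonneg {i j : B} (hij : i ≠ j) {k : ℕ}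
    (hk : S.M i j = 0 ∨ k ≤ S.M i j) : 0 ≤ dihedralCoeff (-mink (S.e i) (S.e j)) k := by
  rcases S.gram i j hij with ⟨h0, h⟩ | ⟨_, h⟩
  · have hk' : k ≤ S.M i j := hk.resolve_left h0
    have h2 := S.two_le hij h0
    have hm0 : (0 : ℝ) < S.M i j := by exact_mod_cast (by omega : 0 < S.M i j)
    have hm2 : (2 : ℝ) ≤ S.M i j := by exact_mod_cast h2
    have hkm : (k : ℝ) ≤ S.M i j := by exact_mod_cast hk'
    have hθpos : 0 < Real.pi / S.M i j := div_pos Real.pi_pos hm0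
    have hθlt : Real.pi / S.M i j < Real.pi := by
      rw [div_lt_iff₀ hm0]
      nlinarith [Real.pi_pos]
    have hs := Real.sin_pos_of_pos_of_lt_pi hθpos hθlt
    have h3 := (dihedralCoeff_cos (Real.pi / S.M i j) k).1
    rw [h, neg_neg]
    have h4 : 0 ≤ Real.sin (k * (Real.pi / S.M i j)) := by
      apply Real.sin_nonneg_of_nonneg_of_le_pi (by positivity)
      rw [← mul_div_assoc, div_le_iff₀ hm0]
      nlinarith [Real.pi_pos]
    by_contra! hneg
    nlinarith
  · exact (dihedralCoeff_of_one_le (by linarith) k).1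

theorem lin_alternatingWord (i j : B) (k : ℕ) :
    S.lin (S.cs.wordProd (CoxeterSystem.alternatingWord i j k)) (S.e i) =
      if Even k then dihedralCoeff (-mink (S.e i) (S.e j)) (k + 1) • S.e i
        + dihedralCoeff (-mink (S.e i) (S.e j)) k • S.e j
      else dihedralCoeff (-mink (S.e i) (S.e j)) k • S.e i
        + dihedralCoeff (-mink (S.e i) (S.e j)) (k + 1) • S.e j := by
  induction k with
  | zero => simp [CoxeterSystem.alternatingWord, dihedralCoeff]
  | succ k ih =>
    rw [CoxeterSystem.alternatingWord_succ', S.cs.wordProd_cons, lin_mul, ih]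
    by_cases hk : Even k
    · have hk' : ¬ Even (k + 1) := by rw [Nat.even_add_one]; simpa using hk
      rw [if_pos hk, if_pos hk, if_neg hk', lin_simple, dihedralCoeff_add_two]
      simp only [mink_add_left, mink_smul_left, S.unit]
      module
    · have hk' : Even (k + 1) := by rw [Nat.even_add_one]; exact hk
      rw [if_neg hk, if_neg hk, if_pos hk', lin_simple, dihedralCoeff_add_two]
      simp only [mink_add_left, mink_smul_left, S.unit, mink_comm (S.e j) (S.e i)]
      module

/-- Tits's theorem: if `w s_i` is longer than `w`, then the root `w e_i` is positive, in the
sense that the chamber lies on its negative side. -/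
theorem mink_lin_nonpos (w : S.M.Group) (i : B) (hw : ¬ S.cs.IsRightDescent w i) :
    ∀ q ∈ S.chamber, mink q (S.lin w (S.e i)) ≤ 0 := by
  induction hN : S.cs.length w using Nat.strong_induction_on generalizing w i with
  | _ N IH =>
  subst hN
  intro q hq
  by_cases hw1 : w = 1
  · subst hw1
    simpa using hq i
  obtain ⟨j, hj⟩ := S.cs.exists_rightDescent_of_ne_one hw1
  have hij : i ≠ j := by rintro rfl; exact hw hj
  let alt : ℕ → List B := fun k => CoxeterSystem.alternatingWord i j k
  have altlen : ∀ k, (alt k).length = k := fun k => CoxeterSystem.length_alternatingWord i j k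
  have altsucc : ∀ k, alt (k + 1) = (if Even k then j else i) :: alt k := fun k =>
    CoxeterSystem.alternatingWord_succ' i j k
  -- `w` has a reduced expression ending in an alternating word of length `k`.
  let P : ℕ → Prop := fun k => ∃ v, w = v * S.cs.wordProd (alt k) ∧
    S.cs.length w = S.cs.length v + k
  have hP1 : P 1 := by
    refine ⟨w * S.cs.simple j, ?_, ?_⟩
    · simp [alt, CoxeterSystem.alternatingWord]
    · exact (S.cs.isRightDescent_iff.mp hj).symm
  have hPdown : ∀ k, P (k + 1) → P k := by
    rintro k ⟨v, hv, hl⟩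
    rw [altsucc, S.cs.wordProd_cons, ← mul_assoc] at hv
    refine ⟨_, hv, ?_⟩
    have h1 := S.cs.length_mul_le (v * S.cs.simple (if Even k then j else i))
      (S.cs.wordProd (alt k))
    have h2 := S.cs.length_wordProd_le (alt k)
    have h3 := S.cs.length_mul_le v (S.cs.simple (if Even k then j else i))
    rw [altlen] at h2
    rw [S.cs.length_simple] at h3
    rw [← hv] at h1
    omega
  have hPdown' : ∀ k l, l ≤ k → P k → P l := by
    intro k l hkl
    induction hkl with
    | refl => exact id
    | step _ ih => exact fun h => ih (hPdown _ h)
  have hPM : S.M i j ≠ 0 → ¬ P (S.M i j) := by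
    rintro hM0 ⟨v, hv, hl⟩
    apply hw
    have hb : S.cs.wordProd (alt (S.M i j))
        = S.cs.wordProd (CoxeterSystem.alternatingWord j i (S.M i j)) := by
      have := S.cs.wordProd_braidWord_eq i j
      rwa [CoxeterSystem.braidWord, CoxeterSystem.braidWord, S.M.symmetric j i] at this
    obtain ⟨m, hm⟩ := Nat.exists_eq_succ_of_ne_zero hM0
    rw [hb, hm, Nat.succ_eq_add_one, CoxeterSystem.alternatingWord_succ, S.cs.wordProd_concat,
      ← mul_assoc] at hv
    have h1 : w * S.cs.simple i = v * S.cs.wordProd (alt m) := by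
      rw [hv, mul_assoc, S.cs.simple_mul_simple_self, mul_one]
    have h2 := S.cs.length_mul_le v (S.cs.wordProd (alt m))
    have h3 := S.cs.length_wordProd_le (alt m)
    rw [altlen] at h3
    rw [CoxeterSystem.IsRightDescent, h1]
    omega
  classical
  have hPle : ∀ k, P k → k ≤ S.cs.length w := by
    rintro k ⟨v, _, hl⟩
    omega
  obtain ⟨k, hPk, hk1, hnot⟩ : ∃ k, P k ∧ 1 ≤ k ∧ ¬ P (k + 1) := by
    refine ⟨Nat.findGreatest P (S.cs.length w), Nat.findGreatest_spec (hPle 1 hP1) hP1,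
      Nat.le_findGreatest (hPle 1 hP1) hP1, fun h => ?_⟩
    have := Nat.le_findGreatest (hPle _ h) h
    omega
  have hkM : S.M i j = 0 ∨ k + 1 ≤ S.M i j := by
    by_cases h0 : S.M i j = 0
    · exact Or.inl h0
    · right
      by_contra! hlt
      exact hPM h0 (hPdown' k _ (by omega) hPk)
  obtain ⟨v, hv, hl⟩ := hPk
  have hnext : ¬ S.cs.IsRightDescent v (if Even k then j else i) := by
    intro hd
    apply hnot
    refine ⟨v * S.cs.simple (if Even k then j else i), ?_, ?_⟩
    · rw [altsucc, S.cs.wordProd_cons, mul_assoc, S.cs.simple_mul_simple_cancel_left, ← hv]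
    · have := S.cs.isRightDescent_iff.mp hd
      omega
  have hprev : ¬ S.cs.IsRightDescent v (if Even k then i else j) := by
    intro hd
    obtain ⟨m, rfl⟩ : ∃ m, k = m + 1 := ⟨k - 1, by omega⟩
    have hlet : (if Even (m + 1) then i else j) = (if Even m then j else i) := by
      by_cases hm : Even m
      · rw [if_pos hm, if_neg (by rw [Nat.even_add_one]; simpa using hm)]
      · rw [if_neg hm, if_pos (by rw [Nat.even_add_one]; exact hm)]
    rw [hlet] at hd
    rw [altsucc, S.cs.wordProd_cons, ← mul_assoc] at hv
    have h1 := S.cs.length_mul_le (v * S.cs.simple (if Even m then j else i))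
      (S.cs.wordProd (alt m))
    have h2 := S.cs.length_wordProd_le (alt m)
    have h3 := S.cs.isRightDescent_iff.mp hd
    rw [altlen] at h2
    rw [← hv] at h1
    omega
  have hboth : ¬ S.cs.IsRightDescent v i ∧ ¬ S.cs.IsRightDescent v j := by
    by_cases hke : Even k
    · rw [if_pos hke] at hnext hprev
      exact ⟨hprev, hnext⟩
    · rw [if_neg hke] at hnext hprev
      exact ⟨hnext, hprev⟩
  have hvi := IH _ (by omega) v i hboth.1 rfl q hq
  have hvj := IH _ (by omega) v j hboth.2 rfl q hq
  have hc1 := S.dihedralCoeff_nonneg hij hkM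
  have hc0 : 0 ≤ dihedralCoeff (-mink (S.e i) (S.e j)) k :=
    S.dihedralCoeff_nonneg hij (hkM.imp id fun h => by omega)
  have hroot := S.lin_alternatingWord i j k
  rw [hv, lin_mul, hroot]
  split_ifs
  · simp only [map_add, map_smul, mink_add_right, mink_smul_right]
    nlinarith [mul_nonneg hc1 (neg_nonneg.mpr hvi), mul_nonneg hc0 (neg_nonneg.mpr hvj)]
  · simp only [map_add, map_smul, mink_add_right, mink_smul_right]
    nlinarith [mul_nonneg hc0 (neg_nonneg.mpr hvi), mul_nonneg hc1 (neg_nonneg.mpr hvj)]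

theorem mink_lin_nonneg (w : S.M.Group) (i : B) (hw : S.cs.IsRightDescent w i) :
    ∀ q ∈ S.chamber, 0 ≤ mink q (S.lin w (S.e i)) := by
  intro q hq
  have h := S.mink_lin_nonpos (w * S.cs.simple i) i
    (S.cs.isRightDescent_iff_not_isRightDescent_mul.mp hw) q hq
  rw [lin_mul, lin_simple, S.unit] at h
  have e1 : S.e i - (2 * 1 : ℝ) • S.e i = -S.e i := by module
  rw [e1, map_neg, mink_neg_right] at h
  linarith

/-- A nontrivial element that fixes a point of the chamber has a right descent at a wall through
that point. -/
theorem exists_descent_of_fixed {w : S.M.Group} (hw : w ≠ 1) {q : Fin (n + 1) → ℝ}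
    (hq : q ∈ S.chamber) (hfix : S.lin w q = q) :
    ∃ i, S.cs.IsRightDescent w i ∧ mink q (S.e i) = 0 := by
  obtain ⟨i, hi⟩ := S.cs.exists_rightDescent_of_ne_one hw
  refine ⟨i, hi, le_antisymm (hq i) ?_⟩
  have h := S.mink_lin_nonneg w i hi q hq
  rwa [← hfix, mink_lin] at h

theorem eq_one_of_fixed_interior {w : S.M.Group} {q : Fin (n + 1) → ℝ}
    (hq : ∀ i, mink q (S.e i) < 0) (hfix : S.lin w q = q) : w = 1 := by
  by_contra hw
  obtain ⟨i, _, hi⟩ := S.exists_descent_of_fixed hw (fun i => (hq i).le) hfix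
  exact absurd hi (hq i).ne

theorem rho_injective : Function.Injective S.rho := by
  rw [injective_iff_map_eq_one]
  intro w hw
  refine S.eq_one_of_fixed_interior S.base_neg ?_
  rw [lin_apply, hw, map_one, Module.End.one_apply]

/-- A nontrivial element that fixes a relative interior point of the `j`-th wall, or of the
chamber, is the reflection in the `j`-th wall. -/
theorem eq_simple_of_fixed {w : S.M.Group} (hw : w ≠ 1) {q : Fin (n + 1) → ℝ} {j : B}
    (hqj : mink q (S.e j) ≤ 0) (hq : ∀ i, i ≠ j → mink q (S.e i) < 0)
    (hfix : S.lin w q = q) : w = S.cs.simple j := by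
  have hqc : q ∈ S.chamber := fun i => by
    by_cases hi : i = j
    · rw [hi]; exact hqj
    · exact (hq i hi).le
  obtain ⟨i, hi, hi0⟩ := S.exists_descent_of_fixed hw hqc hfix
  obtain rfl : i = j := by
    by_contra hne
    exact absurd hi0 (hq i hne).ne
  have hfix' : S.lin (w * S.cs.simple i) q = q := by
    rw [lin_mul, lin_simple, hi0]; simpa using hfix
  by_cases h1 : w * S.cs.simple i = 1
  · rw [mul_eq_one_iff_eq_inv, S.cs.inv_simple] at h1
    exact h1
  · obtain ⟨k, hk, hk0⟩ := S.exists_descent_of_fixed h1 hqc hfix'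
    obtain rfl : k = i := by
      by_contra hne
      exact absurd hk0 (hq k hne).ne
    exact absurd hk (S.cs.isRightDescent_iff_not_isRightDescent_mul.mp hi)

end MirrorSystem

/-! ### The images of the chamber cover hyperbolic space -/

section Covering

variable {n : ℕ}

/-- A point of `H^n` closer to `x` than the hyperplane `e^⊥` is on the same side of it as `x`. -/
theorem mink_neg_of_near {x z : Hyp n} {e : Fin (n + 1) → ℝ} (he : mink e e = 1)
    (hx : mink x.1 e < 0) (hz : mink z.1 x.1 ^ 2 < 1 + mink x.1 e ^ 2) : mink z.1 e < 0 := by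
  have hxx := x.2.1
  have hzz := z.2.1
  have hzx := z.mink_neg x
  set c := mink z.1 x.1 with hc
  set p := mink x.1 e with hp
  have hcs := mink_sq_le_of_orthogonal (x := x.1) (u := z.1 + c • x.1) (v := e + p • x.1)
    x.self_neg (by rw [mink_add_right, mink_smul_right, hxx, mink_comm, ← hc]; ring)
    (by rw [mink_add_right, mink_smul_right, hxx, ← hp]; ring)
  simp only [mink_add_left, mink_add_right, mink_smul_left, mink_smul_right, hxx, hzz, he,
    mink_comm x.1 z.1, mink_comm e x.1, ← hc, ← hp] at hcs
  by_contra! hneg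
  have h1 : 0 < c * p := mul_pos_of_neg_of_neg hzx hx
  nlinarith

/-- A point of `H^n` within a bounded distance of `y` has bounded coordinates. -/
theorem coord_zero_le {y v : Hyp n} {R : ℝ} (hR : -mink y.1 v.1 ≤ R) : v.1 0 ≤ 2 * y.1 0 * R := by
  have hyy := y.2.1
  have hvv := v.2.1
  have h1 := y.mink_le v
  have hy0 := y.2.2
  have hv0 := v.2.2
  unfold mink at hyy hvv hR h1
  have hcs := Finset.sum_mul_sq_le_sq_mul_sq Finset.univ
    (fun i : Fin n => y.1 i.succ) (fun i : Fin n => v.1 i.succ)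
  simp only [pow_two] at hcs
  set T := ∑ i : Fin n, y.1 i.succ * v.1 i.succ
  set Y := ∑ i : Fin n, y.1 i.succ * y.1 i.succ
  set U := ∑ i : Fin n, v.1 i.succ * v.1 i.succ
  have hY0 : 0 ≤ Y := Finset.sum_nonneg fun i _ => mul_self_nonneg _
  have hY : Y = y.1 0 * y.1 0 - 1 := by linarith
  have hU : U = v.1 0 * v.1 0 - 1 := by linarith
  generalize y.1 0 = a at *
  generalize v.1 0 = b at *
  have ha1 : 1 ≤ a := by nlinarith
  have hR1 : 1 ≤ R := by linarith
  by_contra! hlt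
  have h2 : 0 ≤ a * b - R := by nlinarith [mul_le_mul ha1 ha1 zero_le_one hy0.le]
  have h3 : (a * b - R) * (a * b - R) ≤ T * T :=
    mul_self_le_mul_self h2 (by linarith)
  rw [hY, hU] at hcs
  nlinarith

theorem norm_le_coord_zero (v : Hyp n) : ‖v.1‖ ≤ v.1 0 := by
  rw [pi_norm_le_iff_of_nonneg v.2.2.le]
  intro k
  have hv := v.2.1
  unfold mink at hv
  have hv0 := v.2.2
  rw [Real.norm_eq_abs]
  refine Fin.cases ?_ (fun i => ?_) k
  · rw [abs_of_pos hv0]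
  · have h : v.1 i.succ * v.1 i.succ ≤ ∑ i : Fin n, v.1 i.succ * v.1 i.succ :=
      Finset.single_le_sum (f := fun i : Fin n => v.1 i.succ * v.1 i.succ)
        (fun i _ => mul_self_nonneg _) (Finset.mem_univ i)
    refine abs_le_of_sq_le_sq ?_ hv0.le
    nlinarith

theorem mink_self_le_norm (u : Fin (n + 1) → ℝ) : mink u u ≤ n * ‖u‖ ^ 2 := by
  unfold mink
  have h : ∑ i : Fin n, u i.succ * u i.succ ≤ ∑ _i : Fin n, ‖u‖ ^ 2 := by
    refine Finset.sum_le_sum fun i _ => ?_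
    have h1 := norm_le_pi_norm u i.succ
    rw [Real.norm_eq_abs] at h1
    nlinarith [abs_nonneg (u i.succ), abs_mul_abs_self (u i.succ)]
  rw [Finset.sum_const, Finset.card_univ, Fintype.card_fin, nsmul_eq_mul] at h
  nlinarith [mul_self_nonneg (u 0)]

namespace MirrorSystem

variable {B : Type*} (S : MirrorSystem n B)

theorem lin_coe (w : S.M.Group) (x : Hyp n) : S.lin w x.1 = ((S.rho w).1 x).1 := hypLin_coe _ x

open Filter Topology in
/-- The base point is isolated in its orbit. -/
theorem exists_gap [Finite B] :
    ∃ c : ℝ, 1 < c ∧ ∀ w : S.M.Group, -mink (S.lin w S.base.1) S.base.1 ≤ c → w = 1 := by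
  have h : ∀ᶠ c : ℝ in 𝓝[>] 1, ∀ i, c ^ 2 < 1 + mink S.base.1 (S.e i) ^ 2 := by
    refine eventually_all.mpr fun i => ?_
    have hc : Tendsto (fun c : ℝ => c ^ 2) (𝓝[>] 1) (𝓝 (1 ^ 2)) :=
      ((continuous_pow 2).tendsto 1).mono_left nhdsWithin_le_nhds
    refine hc.eventually_lt_const ?_
    have := S.base_neg i
    nlinarith
  obtain ⟨c, hc, hc1⟩ := (h.and self_mem_nhdsWithin).exists
  refine ⟨c, hc1, fun w hw => ?_⟩
  rw [lin_coe] at hw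
  have hneg : ∀ i, mink ((S.rho w).1 S.base).1 (S.e i) < 0 := by
    intro i
    refine mink_neg_of_near (S.unit i) (S.base_neg i) (lt_of_le_of_lt ?_ (hc i))
    have := ((S.rho w).1 S.base).mink_neg S.base
    nlinarith
  by_contra hw1
  have hw1' : w⁻¹ ≠ 1 := inv_ne_one.mpr hw1
  obtain ⟨i, hi⟩ := S.cs.exists_rightDescent_of_ne_one hw1'
  have h1 := S.mink_lin_nonneg _ i hi _ S.base_mem_chamber
  rw [← mink_lin_left, lin_coe] at h1
  exact absurd (hneg i) (not_lt.mpr h1)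

/-- The orbit of the base point is locally finite. -/
theorem finite_setOf_mink_le [Finite B] (y : Hyp n) (R : ℝ) :
    {w : S.M.Group | -mink y.1 (S.lin w S.base.1) ≤ R}.Finite := by
  obtain ⟨c, hc1, hc⟩ := S.exists_gap
  by_contra hinf
  -- By compactness, infinitely many orbit points would come arbitrarily close to each other.
  obtain ⟨δ, hδ, hδn⟩ : ∃ δ : ℝ, 0 < δ ∧ n * (2 * δ) ^ 2 ≤ 2 * (c - 1) := by
    have h1 : 0 < min 1 ((c - 1) / (2 * (n + 1))) :=
      lt_min one_pos (div_pos (by linarith) (by positivity))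
    refine ⟨_, h1, ?_⟩
    set δ := min 1 ((c - 1) / (2 * (n + 1)))
    have h2 : δ ≤ 1 := min_le_left _ _
    have h3 : δ * (2 * (n + 1)) ≤ c - 1 :=
      (le_div_iff₀ (by positivity)).mp (min_le_right _ _)
    have hn : (0 : ℝ) ≤ n := Nat.cast_nonneg n
    nlinarith [mul_nonneg hn h1.le, mul_nonneg (mul_nonneg hn h1.le) (sub_nonneg.mpr h2)]
  obtain ⟨t, _, htfin, ht⟩ := Metric.finite_approx_of_totallyBounded
    (isCompact_closedBall (0 : Fin (n + 1) → ℝ) (2 * y.1 0 * R)).totallyBounded δ hδ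
  have hcenter : ∀ w : S.M.Group, -mink y.1 (S.lin w S.base.1) ≤ R →
      ∃ a ∈ t, dist (S.lin w S.base.1) a < δ := by
    intro w hw
    have h1 : S.lin w S.base.1 ∈ Metric.closedBall (0 : Fin (n + 1) → ℝ) (2 * y.1 0 * R) := by
      rw [lin_coe] at hw ⊢
      rw [mem_closedBall_zero_iff]
      exact (norm_le_coord_zero _).trans (coord_zero_le hw)
    have h2 := ht h1
    simp only [Set.mem_iUnion, Metric.mem_ball, exists_prop] at h2
    exact h2
  choose! a ha using hcenter
  obtain ⟨w, hw, w', hw', hne, heq⟩ := Set.Infinite.exists_ne_map_eq_of_mapsTo hinf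
    (f := a) (t := t) (fun w hw => (ha w hw).1) htfin
  apply hne
  have h1 := (ha w hw).2
  have h2 := (ha w' hw').2
  rw [← heq] at h2
  have h3 : ‖S.lin w S.base.1 - S.lin w' S.base.1‖ ≤ 2 * δ := by
    rw [← dist_eq_norm]
    linarith [dist_triangle_right (S.lin w S.base.1) (S.lin w' S.base.1) (a w)]
  have h4 := mink_self_le_norm (S.lin w S.base.1 - S.lin w' S.base.1)
  have h5 : ‖S.lin w S.base.1 - S.lin w' S.base.1‖ ^ 2 ≤ (2 * δ) ^ 2 :=
    pow_le_pow_left₀ (norm_nonneg _) h3 2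
  have h6 := mul_le_mul_of_nonneg_left h5 (Nat.cast_nonneg (α := ℝ) n)
  have hbb := S.base.2.1
  simp only [mink_sub_left, mink_sub_right, mink_lin, mink_comm (S.lin w' S.base.1)] at h4
  rw [hbb] at h4
  have h7 : w'⁻¹ * w = 1 := by
    refine hc _ ?_
    rw [lin_mul, mink_lin_left, inv_inv]
    linarith
  exact (inv_mul_eq_one.mp h7).symm

/-- The images of the chamber under the reflection group cover `H^n`: an element that moves `y`
as close as possible to the base point moves it into the chamber. -/
theorem exists_lin_mem_chamber [Finite B] (y : Hyp n) :
    ∃ w : S.M.Group, S.lin w⁻¹ y.1 ∈ S.chamber := by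
  obtain ⟨w, hw, hmin⟩ := Set.exists_min_image
    {w : S.M.Group | -mink y.1 (S.lin w S.base.1) ≤ -mink y.1 (S.lin 1 S.base.1)}
    (fun w => -mink y.1 (S.lin w S.base.1)) (S.finite_setOf_mink_le y _)
    ⟨1, le_refl (-mink y.1 (S.lin 1 S.base.1))⟩
  refine ⟨w, fun i => ?_⟩
  by_contra! hi
  have h1 : -mink y.1 (S.lin (w * S.cs.simple i) S.base.1) < -mink y.1 (S.lin w S.base.1) := by
    have h2 := S.base_neg i
    rw [mink_lin_left, inv_inv] at hi
    rw [lin_mul, lin_simple, map_sub, map_smul, mink_sub_right, mink_smul_right]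
    nlinarith
  exact absurd (hmin _ (h1.le.trans hw)) (not_le.mpr h1)

/-! ### Mirrors separating points of an orbit -/

theorem mink_lin_base_ne_zero {τ : S.M.Group} {β : Fin (n + 1) → ℝ} {hβ : mink β β = 1}
    (hτ : S.rho τ = hypReflection β hβ) (w : S.M.Group) : mink (S.lin w S.base.1) β ≠ 0 := by
  intro h0
  have h1 : S.lin (w⁻¹ * τ * w) S.base.1 = S.base.1 := by
    rw [lin_mul, lin_mul, lin_apply S τ, hτ, hypLin_reflection, h0, mul_zero, zero_smul, sub_zero,
      ← lin_mul, inv_mul_cancel, map_one, Module.End.one_apply]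
  have h2 := S.eq_one_of_fixed_interior S.base_neg h1
  have h3 : τ = 1 := by
    have : τ = w * (w⁻¹ * τ * w) * w⁻¹ := by group
    rw [this, h2]; group
  rw [h3, map_one] at hτ
  exact hypReflection_ne_one hβ hτ.symm

theorem rho_conj_simple (w : S.M.Group) (i : B) :
    S.rho (w * S.cs.simple i * w⁻¹) = hypReflection (S.lin w (S.e i))
      (by rw [mink_lin, S.unit]) := by
  rw [map_mul, map_mul, map_inv, rho_simple, refl, conj_hypReflection]
  rfl

/-- The only mirror of the reflection group that separates the chamber from an adjacent one is
their common wall. -/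
theorem eq_simple_of_separates {τ : S.M.Group} {β : Fin (n + 1) → ℝ} {hβ : mink β β = 1}
    (hτ : S.rho τ = hypReflection β hβ) {j : B} (h0 : mink S.base.1 β < 0)
    (h1 : 0 < mink (S.lin (S.cs.simple j) S.base.1) β) : τ = S.cs.simple j := by
  rw [lin_simple, mink_sub_left, mink_smul_left] at h1
  have hp := S.base_neg j
  set p := mink S.base.1 (S.e j) with hpdef
  set q := mink S.base.1 β with hqdef
  set r := mink (S.e j) β with hrdef
  have hr : 0 < r := by nlinarith
  have hτ1 : τ ≠ 1 := by
    rintro rfl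
    rw [map_one] at hτ
    exact hypReflection_ne_one hβ hτ.symm
  -- The segment between the two base points meets the mirror at the parameter `t`.
  set t := -q / r with ht
  have htr : t * r = -q := by rw [ht]; field_simp
  have ht0 : 0 < t := div_pos (by linarith) hr
  have ht1 : t < -2 * p := by
    rw [ht, div_lt_iff₀ hr]; linarith
  have hfix : S.lin τ (S.base.1 + t • S.e j) = S.base.1 + t • S.e j := by
    rw [lin_apply, hτ, hypLin_reflection, mink_add_left, mink_smul_left, ← hqdef, ← hrdef, htr]
    simp
  have hother : ∀ s : ℝ, 0 ≤ s → ∀ i, i ≠ j → mink (S.base.1 + s • S.e j) (S.e i) < 0 := by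
    intro s hs i hij
    rw [mink_add_left, mink_smul_left]
    have := mul_nonneg hs (neg_nonneg.mpr (S.mink_e_nonpos (Ne.symm hij)))
    linarith [S.base_neg i]
  rcases le_or_gt t (-p) with htp | htp
  · refine S.eq_simple_of_fixed hτ1 ?_ (hother t ht0.le) hfix
    rw [mink_add_left, mink_smul_left, S.unit]
    linarith
  · have hrefl : S.lin (S.cs.simple j) (S.base.1 + t • S.e j)
        = S.base.1 + (-2 * p - t) • S.e j := by
      rw [lin_simple, mink_add_left, mink_smul_left, S.unit, ← hpdef]
      module
    have h2 : S.cs.simple j * τ * S.cs.simple j = S.cs.simple j := by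
      refine S.eq_simple_of_fixed ?_ (q := S.base.1 + (-2 * p - t) • S.e j) ?_
        (hother _ (by linarith)) ?_
      · intro h
        apply hτ1
        have : τ = S.cs.simple j * (S.cs.simple j * τ * S.cs.simple j) * S.cs.simple j := by
          simp [mul_assoc]
        rw [this, h]; simp
      · rw [mink_add_left, mink_smul_left, S.unit]
        linarith
      · rw [← hrefl, ← lin_mul, mul_assoc, S.cs.simple_mul_simple_self, mul_one, lin_mul, hfix]
    have : τ = S.cs.simple j * (S.cs.simple j * τ * S.cs.simple j) * S.cs.simple j := by
      simp [mul_assoc]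
    rw [this, h2]; simp

/-- A mirror of the reflection group that separates the base point from its image under the
product of a word is one of the mirrors crossed by the corresponding gallery. -/
theorem exists_split_of_separates (ω : List B) {τ : S.M.Group} {β : Fin (n + 1) → ℝ}
    {hβ : mink β β = 1} (hτ : S.rho τ = hypReflection β hβ) (h0 : mink S.base.1 β < 0)
    (h1 : 0 < mink (S.lin (S.cs.wordProd ω) S.base.1) β) :
    ∃ ω₁ i ω₂, ω = ω₁ ++ i :: ω₂ ∧
      τ = S.cs.wordProd ω₁ * S.cs.simple i * (S.cs.wordProd ω₁)⁻¹ := by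
  induction ω generalizing τ β with
  | nil =>
    rw [S.cs.wordProd_nil, map_one, Module.End.one_apply] at h1
    exact absurd h1 (not_lt.mpr h0.le)
  | cons i ω ih =>
    rcases lt_or_gt_of_ne (S.mink_lin_base_ne_zero hτ (S.cs.simple i)) with h | h
    · have hβ' : mink (S.lin (S.cs.simple i) β) (S.lin (S.cs.simple i) β) = 1 := by
        rw [mink_lin, hβ]
      have hτ' : S.rho (S.cs.simple i * τ * S.cs.simple i)
          = hypReflection (S.lin (S.cs.simple i) β) hβ' := by
        have := conj_hypReflection (S.rho (S.cs.simple i)) hβ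
        rw [← hτ, ← map_inv, S.cs.inv_simple, ← map_mul, ← map_mul] at this
        exact this
      have hflip : ∀ v, mink v (S.lin (S.cs.simple i) β) = mink (S.lin (S.cs.simple i) v) β := by
        intro v
        rw [mink_lin_left, S.cs.inv_simple]
      obtain ⟨ω₁, k, ω₂, hω, hk⟩ := ih hτ' (by rw [hflip]; exact h) (by
        rw [hflip, ← lin_mul, ← S.cs.wordProd_cons]; exact h1)
      refine ⟨i :: ω₁, k, ω₂, by rw [hω, List.cons_append], ?_⟩
      have : τ = S.cs.simple i * (S.cs.simple i * τ * S.cs.simple i) * S.cs.simple i := by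
        simp [mul_assoc]
      rw [this, hk, S.cs.wordProd_cons, mul_inv_rev, S.cs.inv_simple]
      simp only [mul_assoc]
    · exact ⟨[], i, ω, rfl, by simpa using S.eq_simple_of_separates hτ h0 h⟩

/-- The mirrors crossed by a reduced gallery separate its ends. -/
theorem separates_of_length_add (u v : S.M.Group) (i : B)
    (hl : S.cs.length (u * S.cs.simple i * v) = S.cs.length u + 1 + S.cs.length v)
    {z : Fin (n + 1) → ℝ} (hz : z ∈ S.chamber) :
    mink z (S.lin u (S.e i)) ≤ 0 ∧
      0 ≤ mink (S.lin (u * S.cs.simple i * v) z) (S.lin u (S.e i)) := by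
  constructor
  · refine S.mink_lin_nonpos u i ?_ z hz
    have := S.cs.length_mul_le (u * S.cs.simple i) v
    rw [CoxeterSystem.IsRightDescent]
    omega
  · have hd : ¬ S.cs.IsRightDescent v⁻¹ i := by
      rw [S.cs.isRightDescent_inv_iff, CoxeterSystem.IsLeftDescent]
      have := S.cs.length_mul_le u (S.cs.simple i * v)
      rw [← mul_assoc] at this
      omega
    have h := S.mink_lin_nonpos v⁻¹ i hd z hz
    rw [lin_mul, lin_mul, mink_lin, lin_simple, mink_sub_left, mink_smul_left, S.unit,
      mink_lin_left]
    linarith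

/-- An isometry `h` that conjugates a subgroup `G'` of the reflection group to another such
subgroup `G`, and moves the base point into the chamber, sends the wall mirrors of `G'` to the
mirrors of `G` crossed by reduced galleries: here `v ∈ G'` is the only reflection of `G'` crossed
by the gallery `ω` from the base chamber to its mirror image, and `u s_i u⁻¹` is a
reflection of `G` crossed by a reduced gallery for the conjugate `t` of `v`. -/
theorem conj_eq_of_only_separating {G G' : Subgroup S.M.Group} {h : HypIsom n}
    (hG : ∀ x ∈ G, ∃ τ ∈ G', S.rho τ = h⁻¹ * S.rho x * h)
    (hz : (h.1 S.base).1 ∈ S.chamber) (ω : List B)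
    (hω : ∀ ω₁ i ω₂, ω = ω₁ ++ i :: ω₂ →
      S.cs.wordProd ω₁ * S.cs.simple i * (S.cs.wordProd ω₁)⁻¹ ∈ G' →
      S.cs.wordProd ω₁ * S.cs.simple i * (S.cs.wordProd ω₁)⁻¹ = S.cs.wordProd ω)
    {u v : S.M.Group} {i : B}
    (ht : S.rho (u * S.cs.simple i * v) = h * S.rho (S.cs.wordProd ω) * h⁻¹)
    (hl : S.cs.length (u * S.cs.simple i * v) = S.cs.length u + 1 + S.cs.length v)
    (hu : u * S.cs.simple i * u⁻¹ ∈ G) :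
    u * S.cs.simple i * v = u * S.cs.simple i * u⁻¹ := by
  obtain ⟨τ, hτG, hτ⟩ := hG _ hu
  have hunit : mink (S.lin u (S.e i)) (S.lin u (S.e i)) = 1 := by rw [mink_lin, S.unit]
  have hτ' : S.rho τ = hypReflection (hypLin n h⁻¹ (S.lin u (S.e i)))
      (by rw [mink_hypLin, hunit]) := by
    rw [hτ, rho_conj_simple, ← conj_hypReflection, inv_inv]
  obtain ⟨s1, s2⟩ := S.separates_of_length_add u v i hl hz
  have e1 : mink S.base.1 (hypLin n h⁻¹ (S.lin u (S.e i)))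
      = mink (h.1 S.base).1 (S.lin u (S.e i)) := by
    rw [← mink_hypLin_left, hypLin_coe]
  have e2 : mink (S.lin (S.cs.wordProd ω) S.base.1) (hypLin n h⁻¹ (S.lin u (S.e i)))
      = mink (S.lin (u * S.cs.simple i * v) (h.1 S.base).1) (S.lin u (S.e i)) := by
    rw [← mink_hypLin_left, lin_apply S (u * S.cs.simple i * v), ht, map_mul, map_mul,
      Module.End.mul_apply, Module.End.mul_apply, ← hypLin_coe, hypLin_inv_apply]
    rfl
  have n1 := S.mink_lin_base_ne_zero hτ' 1
  rw [map_one, Module.End.one_apply] at n1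
  have n2 := S.mink_lin_base_ne_zero hτ' (S.cs.wordProd ω)
  obtain ⟨ω₁, k, ω₂, hsplit, hk⟩ := S.exists_split_of_separates ω hτ'
    (lt_of_le_of_ne (e1 ▸ s1) n1) (lt_of_le_of_ne (e2 ▸ s2) n2.symm)
  have hτω : τ = S.cs.wordProd ω := by
    rw [hk]
    exact hω ω₁ k ω₂ hsplit (hk ▸ hτG)
  apply S.rho_injective
  rw [ht, ← hτω, hτ]
  group

end MirrorSystem

end Covering

/-! ### Reflection subgroups of a Coxeter group from coloured paths -/

/-- An infinite path whose edges are coloured properly by generators of a Coxeter group, such that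
any two of the colours have an infinite label, and a colour and any other generator have an even
or infinite label. The edge `q` joins the vertices `q` and `q + 1`. -/
structure ColouredPath {B : Type*} (M : CoxeterMatrix B) where
  /-- The colours of the edges. -/
  letter : ℕ → B
  letter_ne : ∀ q, letter q ≠ letter (q + 1)
  infinite_label : ∀ p q, letter p ≠ letter q → M (letter p) (letter q) = 0
  even_label : ∀ q j, (∀ p, letter p ≠ j) → Even (M (letter q) j)

namespace ColouredPath

open Classical in
/-- The move along the edge of colour `c` at the vertex `q` of the initial segment with `I`
vertices; a vertex without such an edge stays where it is. -/
noncomputable def step {B : Type*} {M : CoxeterMatrix B} (P : ColouredPath M) (I : ℕ) (c : B)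
    (q : ℕ) : ℕ :=
  if q + 1 < I ∧ P.letter q = c then q + 1
  else if 1 ≤ q ∧ q < I ∧ P.letter (q - 1) = c then q - 1 else q

variable {B : Type*} {M : CoxeterMatrix B} (P : ColouredPath M) (I : ℕ)

theorem step_forward {c : B} {q : ℕ} (hq : q + 1 < I) (hc : P.letter q = c) :
    P.step I c q = q + 1 := if_pos ⟨hq, hc⟩

theorem step_backward {c : B} {q : ℕ} (hq : q + 1 < I) (hc : P.letter q = c) :
    P.step I c (q + 1) = q := by
  have h : ¬ (q + 1 + 1 < I ∧ P.letter (q + 1) = c) := by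
    rintro ⟨_, h⟩
    exact P.letter_ne q (hc.trans h.symm)
  rw [step, if_neg h, if_pos ⟨by omega, hq, by simpa using hc⟩, Nat.add_sub_cancel]

theorem step_stay {c : B} {q : ℕ} (h1 : q + 1 < I → P.letter q ≠ c)
    (h2 : 1 ≤ q → q < I → P.letter (q - 1) ≠ c) : P.step I c q = q := by
  rw [step, if_neg fun h => h1 h.1 h.2, if_neg fun h => h2 h.1 h.2.1 h.2.2]

theorem step_cases (c : B) (q : ℕ) :
    (q + 1 < I ∧ P.letter q = c ∧ P.step I c q = q + 1) ∨
    (∃ p, q = p + 1 ∧ q < I ∧ P.letter p = c ∧ P.step I c q = p) ∨ P.step I c q = q := by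
  by_cases h1 : q + 1 < I ∧ P.letter q = c
  · exact Or.inl ⟨h1.1, h1.2, P.step_forward I h1.1 h1.2⟩
  by_cases h2 : 1 ≤ q ∧ q < I ∧ P.letter (q - 1) = c
  · obtain ⟨p, rfl⟩ : ∃ p, q = p + 1 := ⟨q - 1, by omega⟩
    have h3 : P.letter p = c := by simpa using h2.2.2
    exact Or.inr (Or.inl ⟨p, rfl, h2.2.1, h3, P.step_backward I h2.2.1 h3⟩)
  · exact Or.inr (Or.inr (by rw [step, if_neg h1, if_neg h2]))

theorem step_involutive (c : B) : Function.Involutive (P.step I c) := by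
  intro q
  rcases P.step_cases I c q with ⟨h1, h2, h3⟩ | ⟨p, rfl, h1, h2, h3⟩ | h
  · rw [h3, P.step_backward I h1 h2]
  · rw [h3, P.step_forward I h1 h2]
  · rw [h, h]

theorem step_lt {c : B} {q : ℕ} (hq : q < I) : P.step I c q < I := by
  rcases P.step_cases I c q with ⟨h1, h2, h3⟩ | ⟨p, rfl, h1, h2, h3⟩ | h <;> omega

/-- The involution of the set of vertices that moves along the edges of colour `c`. -/
noncomputable def perm (c : B) : Equiv.Perm ℕ := (P.step_involutive I c).toPerm

theorem perm_apply (c : B) (q : ℕ) : P.perm I c q = P.step I c q := rfl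

theorem perm_mul_self (c : B) : P.perm I c * P.perm I c = 1 :=
  Equiv.ext fun q => P.step_involutive I c q

theorem perm_eq_one {c : B} (hc : ∀ p, P.letter p ≠ c) : P.perm I c = 1 :=
  Equiv.ext fun q => P.step_stay I (fun _ => hc q) fun _ _ => hc (q - 1)

theorem isLiftable_perm : M.IsLiftable (P.perm I) := by
  intro i j
  by_cases hij : i = j
  · subst hij
    rw [M.diagonal, pow_one, perm_mul_self]
  have heven : ∀ c : B, ∀ m : ℕ, Even m → P.perm I c ^ m = 1 := by
    rintro c _ ⟨k, rfl⟩
    rw [← two_mul, pow_mul, pow_two, perm_mul_self, one_pow]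
  by_cases hi : ∀ p, P.letter p ≠ i
  · rw [P.perm_eq_one I hi, one_mul]
    by_cases hj : ∀ p, P.letter p ≠ j
    · rw [P.perm_eq_one I hj, one_pow]
    · push Not at hj
      obtain ⟨q, rfl⟩ := hj
      exact heven _ _ (M.symmetric i _ ▸ P.even_label q i hi)
  · push Not at hi
    obtain ⟨p, rfl⟩ := hi
    by_cases hj : ∀ p, P.letter p ≠ j
    · rw [P.perm_eq_one I hj, mul_one]
      exact heven _ _ (P.even_label p j hj)
    · push Not at hj
      obtain ⟨q, rfl⟩ := hj
      rw [P.infinite_label p q hij, pow_zero]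

variable {W : Type*} [Group W] (cs : CoxeterSystem M W)

/-- The action of the Coxeter group on the vertices of the path. -/
noncomputable def hom : W →* Equiv.Perm ℕ := cs.lift ⟨P.perm I, P.isLiftable_perm I⟩

theorem hom_simple (c : B) (q : ℕ) : P.hom I cs (cs.simple c) q = P.step I c q := by
  rw [hom, cs.lift_apply_simple (P.isLiftable_perm I), perm_apply]

theorem hom_mul (w w' : W) (q : ℕ) : P.hom I cs (w * w') q = P.hom I cs w (P.hom I cs w' q) := by
  rw [map_mul, Equiv.Perm.mul_apply]

theorem hom_lt (w : W) {q : ℕ} (hq : q < I) : P.hom I cs w q < I := by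
  induction w using cs.simple_induction_left with
  | one => simpa using hq
  | mul_simple_left w i ih =>
    rw [hom_mul, hom_simple]
    exact P.step_lt I ih

/-- The stabilizer of a vertex. -/
noncomputable def stab (p : ℕ) : Subgroup W :=
  (MulAction.stabilizer (Equiv.Perm ℕ) p).comap (P.hom I cs)

theorem mem_stab {p : ℕ} {w : W} : w ∈ P.stab I cs p ↔ P.hom I cs w p = p := Iff.rfl

theorem conj_mem_stab {p : ℕ} {w x : W} :
    w * x * w⁻¹ ∈ P.stab I cs p ↔ x ∈ P.stab I cs (P.hom I cs w⁻¹ p) := by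
  rw [mem_stab, mem_stab, hom_mul, hom_mul, map_inv, Equiv.Perm.eq_inv_iff_eq]

/-- The product of the colours on the path from the vertex `0` to the vertex `q`. -/
def transversal (q : ℕ) : W := cs.wordProd ((List.range q).map P.letter)

theorem transversal_succ (q : ℕ) :
    P.transversal cs (q + 1) = P.transversal cs q * cs.simple (P.letter q) := by
  rw [transversal, List.range_succ, List.map_append, cs.wordProd_append, transversal]
  simp

theorem transversal_step {c : B} {q : ℕ} (h : P.step I c q ≠ q) :
    P.transversal cs (P.step I c q) = P.transversal cs q * cs.simple c := by
  rcases P.step_cases I c q with ⟨h1, h2, h3⟩ | ⟨p, rfl, h1, h2, h3⟩ | h'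
  · rw [h3, transversal_succ, h2]
  · rw [h3, transversal_succ, h2, cs.simple_mul_simple_cancel_right]
  · exact absurd h' h

theorem hom_inv_transversal {q : ℕ} (hq : q < I) :
    P.hom I cs (P.transversal cs q)⁻¹ 0 = q := by
  induction q with
  | zero => simp [transversal]
  | succ q ih =>
    rw [transversal_succ, mul_inv_rev, hom_mul, ih (by omega), cs.inv_simple, hom_simple,
      P.step_forward I hq rfl]

theorem hom_transversal {q : ℕ} (hq : q < I) : P.hom I cs (P.transversal cs q) q = 0 := by
  have h := P.hom_inv_transversal I cs hq
  rwa [map_inv, Equiv.Perm.inv_eq_iff_eq, eq_comm] at h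

/-- The product of the colours on the path from the vertex `p` to the vertex `q`. -/
def between (p q : ℕ) : W := (P.transversal cs p)⁻¹ * P.transversal cs q

theorem between_self (p : ℕ) : P.between cs p p = 1 := inv_mul_cancel _

theorem between_step {c : B} {p q : ℕ} (h : P.step I c q ≠ q) :
    P.between cs p (P.step I c q) = P.between cs p q * cs.simple c := by
  rw [between, P.transversal_step I cs h, between, mul_assoc]

theorem hom_inv_between {p q : ℕ} (hp : p < I) (hq : q < I) :
    P.hom I cs (P.between cs p q)⁻¹ p = q := by
  rw [between, mul_inv_rev, inv_inv, hom_mul, P.hom_transversal I cs hp,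
    P.hom_inv_transversal I cs hq]

/-- The reflection in the `c`-wall of the chamber at the vertex `q`, seen from the chamber at the
vertex `p`. -/
def wallReflection (p q : ℕ) (c : B) : W :=
  P.between cs p q * cs.simple c * (P.between cs p q)⁻¹

theorem wallReflection_mem_stab {p q : ℕ} (hp : p < I) (hq : q < I) (c : B) :
    P.wallReflection cs p q c ∈ P.stab I cs p ↔ P.step I c q = q := by
  rw [wallReflection, conj_mem_stab, P.hom_inv_between I cs hp hq, mem_stab, hom_simple]

/-- The stabilizer of a vertex is generated by the reflections at the colours that are missing at
the vertices (Schreier's lemma for the spanning tree given by the path itself). -/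
theorem stab_eq_closure {p : ℕ} (hp : p < I) :
    P.stab I cs p = Subgroup.closure
      {x | ∃ q c, q < I ∧ P.step I c q = q ∧ x = P.wallReflection cs p q c} := by
  apply le_antisymm
  · have key : ∀ w : W, w * (P.between cs p (P.hom I cs w⁻¹ p))⁻¹ ∈ Subgroup.closure
        {x | ∃ q c, q < I ∧ P.step I c q = q ∧ x = P.wallReflection cs p q c} := by
      intro w
      induction w using cs.simple_induction_right with
      | one => simp [between_self]
      | mul_simple_right w i ih =>
        have hq : P.hom I cs w⁻¹ p < I := P.hom_lt I cs _ hp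
        rw [mul_inv_rev, cs.inv_simple, hom_mul, hom_simple]
        set q := P.hom I cs w⁻¹ p
        by_cases h : P.step I i q = q
        · rw [h]
          have h2 := mul_mem ih (Subgroup.subset_closure ⟨q, i, hq, h, rfl⟩)
          rw [wallReflection] at h2
          convert h2 using 1
          group
        · rw [P.between_step I cs h, mul_inv_rev, cs.inv_simple]
          convert ih using 1
          rw [mul_assoc, cs.simple_mul_simple_cancel_left]
    intro w hw
    have h1 := key w
    have h2 : P.hom I cs w⁻¹ p = p := (P.mem_stab I cs).mp (inv_mem hw)
    rwa [h2, between_self, inv_one, mul_one] at h1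
  · rw [Subgroup.closure_le]
    rintro _ ⟨q, c, hq, h, rfl⟩
    exact (P.wallReflection_mem_stab I cs hp hq c).mpr h

theorem index_stab {p : ℕ} (hp : p < I) : (P.stab I cs p).index = I := by
  let _ : MulAction W ℕ := MulAction.compHom ℕ (P.hom I cs)
  have hst : P.stab I cs p = MulAction.stabilizer W p := rfl
  have horb : MulAction.orbit W p = Set.Iio I := by
    ext q
    constructor
    · rintro ⟨w, rfl⟩
      exact P.hom_lt I cs w hp
    · intro hq
      exact ⟨(P.between cs p q)⁻¹, P.hom_inv_between I cs hp hq⟩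
  rw [hst, MulAction.index_stabilizer, horb]
  rw [← Finset.coe_Iio, Set.ncard_coe_finset, Nat.card_Iio]

/-- The first missing edge met by a word: either the word runs along the path, or it runs along
the path up to a letter that is missing at the vertex reached. -/
theorem exists_first_stay {p : ℕ} (hp : p < I) (ω : List B) :
    (∃ ω₁ c ω₂ q, ω = ω₁ ++ c :: ω₂ ∧ q < I ∧ cs.wordProd ω₁ = P.between cs p q ∧
      P.step I c q = q) ∨
    cs.wordProd ω = P.between cs p (P.hom I cs (cs.wordProd ω)⁻¹ p) := by
  induction ω using List.reverseRecOn with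
  | nil => right; simp [between_self]
  | append_singleton ω c ih =>
    rcases ih with ⟨ω₁, d, ω₂, q, rfl, h⟩ | ih
    · left
      exact ⟨ω₁, d, ω₂ ++ [c], q, by simp, h⟩
    · have hq : P.hom I cs (cs.wordProd ω)⁻¹ p < I := P.hom_lt I cs _ hp
      by_cases h : P.step I c (P.hom I cs (cs.wordProd ω)⁻¹ p) = P.hom I cs (cs.wordProd ω)⁻¹ p
      · left
        exact ⟨ω, c, [], _, rfl, hq, ih, h⟩
      · right
        rw [cs.wordProd_append, cs.wordProd_singleton, mul_inv_rev, cs.inv_simple, hom_mul,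
          hom_simple, P.between_step I cs h, ← ih]

/-- A nontrivial element of the stabilizer of a vertex has a reduced expression that crosses one
of the reflections generating the stabilizer. -/
theorem exists_reduced_factorization {p : ℕ} (hp : p < I) {t : W} (ht : t ∈ P.stab I cs p)
    (ht1 : t ≠ 1) :
    ∃ q c v, q < I ∧ P.step I c q = q ∧ t = P.between cs p q * cs.simple c * v ∧
      cs.length t = cs.length (P.between cs p q) + 1 + cs.length v := by
  obtain ⟨ω, hω, rfl⟩ := cs.exists_isReduced t
  rcases P.exists_first_stay I cs hp ω with ⟨ω₁, c, ω₂, q, rfl, hq, h1, h2⟩ | h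
  · have e : cs.wordProd (ω₁ ++ c :: ω₂)
        = P.between cs p q * cs.simple c * cs.wordProd ω₂ := by
      rw [cs.wordProd_append, cs.wordProd_cons, h1, mul_assoc]
    refine ⟨q, c, cs.wordProd ω₂, hq, h2, e, ?_⟩
    have l1 := hω.eq
    have l2 := cs.length_wordProd_le ω₁
    have l3 := cs.length_wordProd_le ω₂
    have l4 := cs.length_mul_le (P.between cs p q * cs.simple c) (cs.wordProd ω₂)
    have l5 := cs.length_mul_le (P.between cs p q) (cs.simple c)
    rw [cs.length_simple] at l5
    rw [← e] at l4
    rw [List.length_append, List.length_cons] at l1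
    rw [h1] at l2
    omega
  · exfalso
    have h2 : P.hom I cs (cs.wordProd ω)⁻¹ p = p := (P.mem_stab I cs).mp (inv_mem ht)
    rw [h2, between_self] at h
    exact ht1 h

end ColouredPath

/-! ### Exponentially many paths -/

/-- Three generators of a Coxeter group such that any two of them have an infinite label and each
of them has an even or infinite label with every other generator. -/
structure DoublingTriple {B : Type*} (M : CoxeterMatrix B) where
  /-- The three generators. -/
  w : Fin 3 → B
  infinite_label : ∀ a b, a ≠ b → M (w a) (w b) = 0
  even_label : ∀ a j, (∀ b, w b ≠ j) → Even (M (w a) j)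

namespace DoublingTriple

variable {B : Type*} {M : CoxeterMatrix B} (T : DoublingTriple M)

theorem w_ne {a b : Fin 3} (h : a ≠ b) : T.w a ≠ T.w b := by
  intro h'
  have h1 := T.infinite_label a b h
  rw [h', M.diagonal] at h1
  exact one_ne_zero h1

/-- The colour pattern `0, 1, 2, *, 2, *, 2, …`, where each star is `0` or `1`, according to a
sequence of bits. -/
def pattern (ε : ℕ → Bool) (q : ℕ) : Fin 3 :=
  if q = 0 then 0 else if q = 1 then 1 else if Even q then 2
  else if ε ((q - 3) / 2) then 0 else 1

theorem pattern_ne (ε : ℕ → Bool) (q : ℕ) : pattern ε q ≠ pattern ε (q + 1) := by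
  have h2 : ∀ b : Bool, (if b then (0 : Fin 3) else 1) ≠ 2 := by decide
  rcases q with _ | _ | q
  · simp [pattern]
  · simp [pattern]
  · by_cases hq : Even q
    · have h1 : ¬ Even (q + 1) := by rw [Nat.even_add_one]; simpa using hq
      simp only [pattern, Nat.even_add_one, h1]
      simpa using (h2 _).symm
    · have h1 : Even (q + 1) := by rw [Nat.even_add_one]; exact hq
      simp only [pattern, Nat.even_add_one, h1]
      simpa using h2 _

/-- The coloured path encoding a sequence of bits. -/
def bitPath (ε : ℕ → Bool) : ColouredPath M where
  letter q := T.w (pattern ε q)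
  letter_ne q := T.w_ne (pattern_ne ε q)
  infinite_label p q h := T.infinite_label _ _ fun h' => h (congrArg T.w h')
  even_label q j h := T.even_label _ j fun b => by
    fin_cases b
    · exact h 0
    · exact h 1
    · exact h 2

variable (ε : ℕ → Bool)

theorem letter_even (k : ℕ) : (T.bitPath ε).letter (2 * k + 2) = T.w 2 := by
  have h : pattern ε (2 * k + 2) = 2 := by simp [pattern, Nat.even_add]
  exact congrArg T.w h

theorem letter_odd (k : ℕ) :
    (T.bitPath ε).letter (2 * k + 3) = T.w (if ε k then 0 else 1) := by
  have h : pattern ε (2 * k + 3) = if ε k then 0 else 1 := by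
    have : ¬ Even (2 * k + 3) := by simp [Nat.even_add, parity_simps]
    simp [pattern, this]
  exact congrArg T.w h

variable {I : ℕ}

theorem step_zero_zero (hI : 3 ≤ I) : (T.bitPath ε).step I (T.w 0) 0 = 1 :=
  (T.bitPath ε).step_forward I (by omega) rfl

theorem step_zero_one (hI : 3 ≤ I) : (T.bitPath ε).step I (T.w 0) 1 = 0 :=
  (T.bitPath ε).step_backward I (by omega) rfl

theorem step_one_one (hI : 3 ≤ I) : (T.bitPath ε).step I (T.w 1) 1 = 2 :=
  (T.bitPath ε).step_forward I (by omega) rfl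

theorem step_one_two (hI : 3 ≤ I) : (T.bitPath ε).step I (T.w 1) 2 = 1 :=
  (T.bitPath ε).step_backward I (by omega) rfl

theorem step_one_zero : (T.bitPath ε).step I (T.w 1) 0 = 0 :=
  (T.bitPath ε).step_stay I (fun _ => T.w_ne (a := 0) (by decide)) (fun h => by omega)

theorem step_zero_two : (T.bitPath ε).step I (T.w 0) 2 = 2 :=
  (T.bitPath ε).step_stay I (fun _ => T.w_ne (a := 2) (by decide))
    (fun _ _ => T.w_ne (a := 1) (by decide))

theorem step_other_one {j : B} (h0 : j ≠ T.w 0) (h1 : j ≠ T.w 1) :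
    (T.bitPath ε).step I j 1 = 1 :=
  (T.bitPath ε).step_stay I (fun _ => h1.symm) (fun _ _ => h0.symm)

open Classical in
/-- For each generator, a word for a reflection that stabilizes the vertex `1` of every path
`bitPath ε`. These reflections together determine all generators. -/
noncomputable def probe (j : B) : List B :=
  if j = T.w 0 then [T.w 1, T.w 0, T.w 1] else if j = T.w 1 then [T.w 0, T.w 1, T.w 0] else [j]

theorem probe_zero : T.probe (T.w 0) = [T.w 1, T.w 0, T.w 1] := if_pos rfl

theorem probe_one : T.probe (T.w 1) = [T.w 0, T.w 1, T.w 0] := by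
  rw [probe, if_neg (T.w_ne (by decide)), if_pos rfl]

theorem probe_other {j : B} (h0 : j ≠ T.w 0) (h1 : j ≠ T.w 1) : T.probe j = [j] := by
  rw [probe, if_neg h0, if_neg h1]

variable {W : Type*} [Group W] (cs : CoxeterSystem M W)

theorem probe_mem_stab (hI : 3 ≤ I) (j : B) :
    cs.wordProd (T.probe j) ∈ (T.bitPath ε).stab I cs 1 := by
  rw [ColouredPath.mem_stab]
  by_cases h0 : j = T.w 0
  · subst h0
    simp [probe_zero, CoxeterSystem.wordProd, ColouredPath.hom_simple, step_one_one,
      step_zero_two, step_one_two, hI]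
  by_cases h1 : j = T.w 1
  · subst h1
    simp [probe_one, CoxeterSystem.wordProd, ColouredPath.hom_simple, step_zero_one,
      step_one_zero, step_zero_zero, hI]
  · simp [probe_other T h0 h1, CoxeterSystem.wordProd, ColouredPath.hom_simple,
      step_other_one T ε h0 h1]

/-- The reflection of a probe is the only one in the stabilizer of the vertex `1` that is crossed
by the word of the probe. -/
theorem probe_split (hI : 3 ≤ I) (j : B) (ω₁ : List B) (i : B) (ω₂ : List B)
    (hω : T.probe j = ω₁ ++ i :: ω₂)
    (hmem : cs.wordProd ω₁ * cs.simple i * (cs.wordProd ω₁)⁻¹ ∈ (T.bitPath ε).stab I cs 1) :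
    cs.wordProd ω₁ * cs.simple i * (cs.wordProd ω₁)⁻¹ = cs.wordProd (T.probe j) := by
  rw [ColouredPath.mem_stab] at hmem
  have hsplit : ∀ x y : B, [x, y, x] = ω₁ ++ i :: ω₂ →
      (ω₁ = [] ∧ i = x) ∨ (ω₁ = [x] ∧ i = y) ∨ (ω₁ = [x, y] ∧ i = x) := by
    intro x y h
    rcases ω₁ with _ | ⟨a, _ | ⟨b, _ | ⟨c, l⟩⟩⟩ <;> simp_all
    exact h.2.2.1.symm.trans h.1
  by_cases h0 : j = T.w 0
  · subst h0
    rw [probe_zero] at hω ⊢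
    rcases hsplit _ _ hω with ⟨rfl, rfl⟩ | ⟨rfl, rfl⟩ | ⟨rfl, rfl⟩
    · simp [ColouredPath.hom_simple, step_one_one, hI] at hmem
    · simp [CoxeterSystem.wordProd, mul_assoc]
    · simp [CoxeterSystem.wordProd, ColouredPath.hom_simple, step_one_one,
        step_zero_two, step_one_two, step_zero_one, step_one_zero, hI, Equiv.Perm.mul_apply] at hmem
  by_cases h1 : j = T.w 1
  · subst h1
    rw [probe_one] at hω ⊢
    rcases hsplit _ _ hω with ⟨rfl, rfl⟩ | ⟨rfl, rfl⟩ | ⟨rfl, rfl⟩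
    · simp [ColouredPath.hom_simple, step_zero_one, hI] at hmem
    · simp [CoxeterSystem.wordProd, mul_assoc]
    · simp [CoxeterSystem.wordProd, ColouredPath.hom_simple, step_one_one,
        step_zero_two, step_zero_zero, step_zero_one, step_one_zero, hI, Equiv.Perm.mul_apply] at hmem
  · rw [probe_other T h0 h1] at hω ⊢
    rcases ω₁ with _ | ⟨a, l⟩
    · simp at hω
      simp [hω.1]
    · simp at hω

/-- The stabilizer of the vertex `1` determines the bits used by the path: at the first difference,
the edge of one path is missing in the other. -/
theorem eq_of_stab_eq {ε ε' : ℕ → Bool} (hI : 3 ≤ I)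
    (h : (T.bitPath ε).stab I cs 1 = (T.bitPath ε').stab I cs 1) {k : ℕ} (hk : 2 * k + 5 ≤ I) :
    ε k = ε' k := by
  induction k using Nat.strong_induction_on with
  | _ k ih =>
  by_contra hne
  have hletter : ∀ q, q < 2 * k + 3 → (T.bitPath ε).letter q = (T.bitPath ε').letter q := by
    intro q hq
    rcases q with _ | _ | q
    · rfl
    · rfl
    · obtain ⟨r, hr⟩ := Nat.even_or_odd' q
      rcases hr with rfl | rfl
      · rw [letter_even, letter_even]
      · rw [letter_odd, letter_odd, ih r (by omega) (by omega)]
  have htrans : ∀ q, q ≤ 2 * k + 3 →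
      (T.bitPath ε).transversal cs q = (T.bitPath ε').transversal cs q := by
    intro q hq
    rw [ColouredPath.transversal, ColouredPath.transversal]
    congr 1
    refine List.map_congr_left fun a ha => hletter a ?_
    have := List.mem_range.mp ha
    omega
  have hwall : ∀ c, (T.bitPath ε).wallReflection cs 1 (2 * k + 3) c
      = (T.bitPath ε').wallReflection cs 1 (2 * k + 3) c := by
    intro c
    rw [ColouredPath.wallReflection, ColouredPath.wallReflection, ColouredPath.between,
      ColouredPath.between, htrans _ le_rfl, htrans 1 (by omega)]
  set c := (T.bitPath ε).letter (2 * k + 3) with hc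
  have h1 : (T.bitPath ε).step I c (2 * k + 3) = 2 * k + 3 + 1 :=
    (T.bitPath ε).step_forward I (by omega) rfl
  have h2 : (T.bitPath ε').step I c (2 * k + 3) = 2 * k + 3 := by
    refine (T.bitPath ε').step_stay I (fun _ => ?_) (fun _ _ => ?_)
    · rw [hc, letter_odd, letter_odd]
      refine T.w_ne ?_
      revert hne
      cases ε k <;> cases ε' k <;> simp
    · have e1 : (T.bitPath ε').letter (2 * k + 3 - 1) = T.w 2 := letter_even T ε' k
      rw [e1, hc, letter_odd]
      refine T.w_ne ?_
      cases ε k <;> simp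
  have h3 := ((T.bitPath ε').wallReflection_mem_stab I cs (p := 1) (by omega)
    (by omega : 2 * k + 3 < I) c).mpr h2
  rw [← hwall, ← h, ColouredPath.wallReflection_mem_stab _ I cs (by omega) (by omega), h1] at h3
  omega

end DoublingTriple

/-! ### Counting conjugate subgroups -/

namespace MirrorSystem

variable {n : ℕ} {B : Type*} (S : MirrorSystem n B) (T : DoublingTriple S.M)

/-- The stabilizer of the vertex `1` of the initial segment with `I` vertices of the path encoding
the bits `ε`, as a group of isometries of `H^n`. -/
noncomputable def pathGroup (I : ℕ) (ε : ℕ → Bool) : Subgroup (HypIsom n) :=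
  ((T.bitPath ε).stab I S.cs 1).map S.rho

theorem conj_hypReflection_eq_self {z : HypIsom n} {e : Fin (n + 1) → ℝ} {he : mink e e = 1}
    (h : hypLin n z e = e ∨ hypLin n z e = -e) :
    z * hypReflection e he * z⁻¹ = hypReflection e he := by
  rw [conj_hypReflection]
  rcases h with h | h
  · exact hypReflection_congr _ _ h
  · rw [hypReflection_congr _ (by rw [mink_neg_left, mink_neg_right, he, neg_neg]) h,
      hypReflection_neg]

theorem hypLin_eq_or_eq_neg {z : HypIsom n} {e : Fin (n + 1) → ℝ} {he : mink e e = 1}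
    (h : z * hypReflection e he * z⁻¹ = hypReflection e he) :
    hypLin n z e = e ∨ hypLin n z e = -e := by
  rw [conj_hypReflection] at h
  exact eq_or_eq_neg_of_hypReflection_eq h.symm

theorem mink_e_le_neg_one {a b : Fin 3} (hab : a ≠ b) :
    mink (S.e (T.w a)) (S.e (T.w b)) ≤ -1 := by
  rcases S.gram _ _ (T.w_ne hab) with ⟨h, _⟩ | ⟨_, h⟩
  · exact absurd (T.infinite_label a b hab) h
  · exact h

/-- The root of a conjugate `s_i s_j s_i`. -/
theorem rho_wordProd_conj (i j : B) :
    S.rho (S.cs.wordProd [i, j, i]) = hypReflection (S.lin (S.cs.simple i) (S.e j))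
      (by rw [mink_lin, S.unit]) := by
  rw [← rho_conj_simple, S.cs.inv_simple]
  simp [CoxeterSystem.wordProd, mul_assoc]

theorem rho_probe (j : B) : ∃ (f : Fin (n + 1) → ℝ) (hf : mink f f = 1),
    S.rho (S.cs.wordProd (T.probe j)) = hypReflection f hf := by
  by_cases h0 : j = T.w 0
  · subst h0
    rw [T.probe_zero]
    exact ⟨_, _, S.rho_wordProd_conj _ _⟩
  by_cases h1 : j = T.w 1
  · subst h1
    rw [T.probe_one]
    exact ⟨_, _, S.rho_wordProd_conj _ _⟩
  · rw [T.probe_other h0 h1, S.cs.wordProd_singleton, rho_simple]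
    exact ⟨_, _, rfl⟩

/-- An isometry commuting with all probes commutes with the whole reflection group. For the
generators `0` and `1` of the triple, with normals `e`, `f`, the roots of the probes are
`e - 2c f` and `f - 2c e` with `c = ⟨e, f⟩ ≤ -1`. They are preserved up to sign, the signs agree
because the roots are not orthogonal, and they span the same plane as `e` and `f`. -/
theorem commute_of_probe {z : HypIsom n}
    (hz : ∀ j, z * S.rho (S.cs.wordProd (T.probe j)) * z⁻¹ = S.rho (S.cs.wordProd (T.probe j)))
    (w : S.M.Group) : z * S.rho w * z⁻¹ = S.rho w := by
  have hroot : ∀ j, hypLin n z (S.e j) = S.e j ∨ hypLin n z (S.e j) = -S.e j := by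
    have hz0 := hz (T.w 0)
    have hz1 := hz (T.w 1)
    rw [T.probe_zero, rho_wordProd_conj] at hz0
    rw [T.probe_one, rho_wordProd_conj] at hz1
    have r0 := hypLin_eq_or_eq_neg hz0
    have r1 := hypLin_eq_or_eq_neg hz1
    have hc := S.mink_e_le_neg_one T (show (0 : Fin 3) ≠ 1 by decide)
    set e := S.e (T.w 0) with he
    set f := S.e (T.w 1) with hf
    set c := mink e f with hcdef
    have u0 : S.lin (S.cs.simple (T.w 1)) e = e - (2 * c) • f := by rw [lin_simple]
    have u1 : S.lin (S.cs.simple (T.w 0)) f = f - (2 * c) • e := by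
      rw [lin_simple, mink_comm, ← he, ← hcdef]
    rw [u0] at r0
    rw [u1] at r1
    have hee : mink e e = 1 := S.unit _
    have hff : mink f f = 1 := S.unit _
    have hprod : mink (e - (2 * c) • f) (f - (2 * c) • e) = c * (4 * c ^ 2 - 3) := by
      simp only [mink_sub_left, mink_sub_right, mink_smul_left, mink_smul_right, hee, hff,
        mink_comm f e, ← hcdef]
      ring
    have hprod0 : mink (e - (2 * c) • f) (f - (2 * c) • e) ≠ 0 := by
      rw [hprod]
      exact mul_ne_zero (by linarith) (by nlinarith)
    have hinv := mink_hypLin z (e - (2 * c) • f) (f - (2 * c) • e)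
    obtain ⟨σ, hσ, s0, s1⟩ : ∃ σ : ℝ, (σ = 1 ∨ σ = -1) ∧
        hypLin n z (e - (2 * c) • f) = σ • (e - (2 * c) • f) ∧
        hypLin n z (f - (2 * c) • e) = σ • (f - (2 * c) • e) := by
      rcases r0 with r0 | r0 <;> rcases r1 with r1 | r1
      · exact ⟨1, Or.inl rfl, by rw [r0, one_smul], by rw [r1, one_smul]⟩
      · exfalso
        rw [r0, r1, mink_neg_right] at hinv
        exact hprod0 (by linarith)
      · exfalso
        rw [r0, r1, mink_neg_left] at hinv
        exact hprod0 (by linarith)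
      · exact ⟨-1, Or.inr rfl, by rw [r0, neg_smul, one_smul], by rw [r1, neg_smul, one_smul]⟩
    have hd : (1 - 4 * c ^ 2 : ℝ) ≠ 0 := by nlinarith
    have hcomb : ∀ x y : Fin (n + 1) → ℝ, hypLin n z (x - (2 * c) • y) = σ • (x - (2 * c) • y) →
        hypLin n z (y - (2 * c) • x) = σ • (y - (2 * c) • x) →
        hypLin n z x = x ∨ hypLin n z x = -x := by
      intro x y hx hy
      have h1 : (1 - 4 * c ^ 2) • x = (x - (2 * c) • y) + (2 * c) • (y - (2 * c) • x) := by
        module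
      have h2 : (1 - 4 * c ^ 2) • hypLin n z x = (1 - 4 * c ^ 2) • (σ • x) := by
        rw [smul_comm (1 - 4 * c ^ 2) σ x, ← map_smul, h1, map_add, map_smul, hx, hy]
        module
      have h3 := smul_right_injective _ hd h2
      rcases hσ with rfl | rfl
      · left; rw [h3, one_smul]
      · right; rw [h3, neg_smul, one_smul]
    intro j
    by_cases h0 : j = T.w 0
    · rw [h0]
      exact hcomb e f s0 s1
    by_cases h1 : j = T.w 1
    · rw [h1]
      exact hcomb f e s1 s0
    · have hzj := hz j
      rw [T.probe_other h0 h1, S.cs.wordProd_singleton, rho_simple] at hzj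
      exact hypLin_eq_or_eq_neg hzj
  induction w using S.cs.simple_induction_left with
  | one => simp
  | mul_simple_left w i ih =>
    have h1 : z * S.rho (S.cs.simple i) * z⁻¹ = S.rho (S.cs.simple i) := by
      rw [rho_simple]
      exact conj_hypReflection_eq_self (hroot i)
    have h2 : z * (S.rho (S.cs.simple i) * S.rho w) * z⁻¹
        = (z * S.rho (S.cs.simple i) * z⁻¹) * (z * S.rho w * z⁻¹) := by group
    rw [map_mul, h2, h1, ih]

/-- A conjugacy between two path groups can be normalized so that it sends the base point into the
chamber, at the price of changing the vertex of one of the paths; it is then described by finitely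
many data, the images of the probes. -/
theorem exists_conj_data [Finite B] {I : ℕ} (hI : 3 ≤ I) {a b : ℕ → Bool}
    (hab : (isomConj n).r (S.pathGroup T I b) (S.pathGroup T I a)) :
    ∃ (h : HypIsom n) (p : Fin I) (d : B → Fin I × B),
      (∀ x, x ∈ S.pathGroup T I b ↔
        h * x * h⁻¹ ∈ ((T.bitPath a).stab I S.cs p).map S.rho) ∧
      ∀ j, h * S.rho (S.cs.wordProd (T.probe j)) * h⁻¹
        = S.rho ((T.bitPath a).wallReflection S.cs p (d j).1 (d j).2) := by
  obtain ⟨g, hg⟩ := hab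
  obtain ⟨w, hw⟩ := S.exists_lin_mem_chamber (g.1 S.base)
  set h : HypIsom n := (S.rho w)⁻¹ * g with hh
  have hp : (T.bitPath a).hom I S.cs w⁻¹ 1 < I := (T.bitPath a).hom_lt I S.cs _ (by omega)
  set p : Fin I := ⟨(T.bitPath a).hom I S.cs w⁻¹ 1, hp⟩ with hpdef
  have hconj : ∀ x, x ∈ S.pathGroup T I b ↔
      h * x * h⁻¹ ∈ ((T.bitPath a).stab I S.cs p).map S.rho := by
    intro x
    have h1 : x ∈ S.pathGroup T I b ↔ g * x * g⁻¹ ∈ S.pathGroup T I a := by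
      rw [hg]
      constructor
      · intro hx
        exact ⟨x, hx, rfl⟩
      · rintro ⟨y, hy, hyx⟩
        have : y = x := by
          have h2 : g * y * g⁻¹ = g * x * g⁻¹ := hyx
          simpa using h2
        exact this ▸ hy
    rw [h1]
    constructor
    · rintro ⟨y, hy, hyx⟩
      refine ⟨w⁻¹ * y * w, ?_, ?_⟩
      · have h2 : w * (w⁻¹ * y * w) * w⁻¹ = y := by group
        exact ((T.bitPath a).conj_mem_stab I S.cs).mp (h2.symm ▸ hy)
      · rw [map_mul, map_mul, hyx, map_inv, hh]
        group
    · rintro ⟨y, hy, hyx⟩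
      refine ⟨w * y * w⁻¹, ((T.bitPath a).conj_mem_stab I S.cs).mpr hy, ?_⟩
      rw [map_mul, map_mul, hyx, map_inv, hh]
      group
  have hz : (h.1 S.base).1 ∈ S.chamber := by
    have e1 : (h.1 S.base).1 = S.lin w⁻¹ (g.1 S.base).1 := by
      rw [lin_apply, map_inv, hypLin_coe]
      rfl
    rw [e1]
    exact hw
  have hGG : ∀ x ∈ (T.bitPath a).stab I S.cs p, ∃ τ ∈ (T.bitPath b).stab I S.cs 1,
      S.rho τ = h⁻¹ * S.rho x * h := by
    intro x hx
    have h1 : h⁻¹ * S.rho x * h ∈ S.pathGroup T I b := by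
      rw [hconj]
      refine ⟨x, hx, ?_⟩
      group
    exact h1
  have hdata : ∀ j, ∃ d : Fin I × B, h * S.rho (S.cs.wordProd (T.probe j)) * h⁻¹
      = S.rho ((T.bitPath a).wallReflection S.cs p d.1 d.2) := by
    intro j
    obtain ⟨t, ht, hteq⟩ := (hconj _).mp
      (⟨_, T.probe_mem_stab b S.cs hI j, rfl⟩ :
        S.rho (S.cs.wordProd (T.probe j)) ∈ S.pathGroup T I b)
    have ht1 : t ≠ 1 := by
      rintro rfl
      obtain ⟨f, hf, hfe⟩ := S.rho_probe T j
      rw [map_one, hfe, conj_hypReflection] at hteq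
      exact hypReflection_ne_one _ hteq.symm
    obtain ⟨q, c, v, hq, hstay, hfac, hlen⟩ :=
      (T.bitPath a).exists_reduced_factorization I S.cs p.2 ht ht1
    refine ⟨(⟨q, hq⟩, c), ?_⟩
    rw [← hteq, hfac]
    refine congrArg S.rho (S.conj_eq_of_only_separating hGG hz (T.probe j)
      (T.probe_split b S.cs hI j) (hfac ▸ hteq) (hfac ▸ hlen) ?_)
    exact ((T.bitPath a).wallReflection_mem_stab I S.cs p.2 hq c).mpr hstay
  choose d hd using hdata
  exact ⟨h, p, d, hconj, hd⟩

/-- The data of a normalized conjugacy determine the path group. -/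
theorem pathGroup_eq_of_data {I : ℕ} {a b b' : ℕ → Bool} {h h' : HypIsom n} {p : Fin I}
    {d : B → Fin I × B}
    (hb : ∀ x, x ∈ S.pathGroup T I b ↔
      h * x * h⁻¹ ∈ ((T.bitPath a).stab I S.cs p).map S.rho)
    (hb' : ∀ x, x ∈ S.pathGroup T I b' ↔
      h' * x * h'⁻¹ ∈ ((T.bitPath a).stab I S.cs p).map S.rho)
    (hd : ∀ j, h * S.rho (S.cs.wordProd (T.probe j)) * h⁻¹
      = S.rho ((T.bitPath a).wallReflection S.cs p (d j).1 (d j).2))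
    (hd' : ∀ j, h' * S.rho (S.cs.wordProd (T.probe j)) * h'⁻¹
      = S.rho ((T.bitPath a).wallReflection S.cs p (d j).1 (d j).2)) :
    S.pathGroup T I b = S.pathGroup T I b' := by
  have hcomm := S.commute_of_probe T (z := h'⁻¹ * h) (by
    intro j
    have h1 := (hd j).trans (hd' j).symm
    calc h'⁻¹ * h * S.rho (S.cs.wordProd (T.probe j)) * (h'⁻¹ * h)⁻¹
        = h'⁻¹ * (h * S.rho (S.cs.wordProd (T.probe j)) * h⁻¹) * h' := by group
      _ = S.rho (S.cs.wordProd (T.probe j)) := by rw [h1]; group)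
  have hrange : ∀ w, h * S.rho w * h⁻¹ = h' * S.rho w * h'⁻¹ := by
    intro w
    calc h * S.rho w * h⁻¹ = h' * (h'⁻¹ * h * S.rho w * (h'⁻¹ * h)⁻¹) * h'⁻¹ := by group
      _ = h' * S.rho w * h'⁻¹ := by rw [hcomm]
  ext x
  constructor
  · rintro ⟨w, hw, rfl⟩
    rw [hb', ← hrange, ← hb]
    exact ⟨w, hw, rfl⟩
  · rintro ⟨w, hw, rfl⟩
    rw [hb, hrange, ← hb']
    exact ⟨w, hw, rfl⟩

/-- A finite sequence of bits, extended by zeros. -/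
def extendBits {m : ℕ} (a : Fin m → Bool) (k : ℕ) : Bool :=
  if h : k < m then a ⟨k, h⟩ else false

/-- A conjugacy class contains only polynomially many of the path groups of index `I`. -/
theorem card_le_of_conj [Fintype B] {I : ℕ} (hI : 3 ≤ I)
    (s : Finset (Fin ((I - 3) / 2) → Bool)) (a : Fin ((I - 3) / 2) → Bool)
    (hs : ∀ b ∈ s, (isomConj n).r (S.pathGroup T I (extendBits b))
      (S.pathGroup T I (extendBits a))) :
    s.card ≤ I * (I * Fintype.card B) ^ Fintype.card B := by
  classical
  have hcard : (Finset.univ : Finset (Fin I × (B → Fin I × B))).card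
      = I * (I * Fintype.card B) ^ Fintype.card B := by
    rw [Finset.card_univ, Fintype.card_prod, Fintype.card_fun, Fintype.card_prod, Fintype.card_fin]
  rw [← hcard]
  have hex := fun b : s => S.exists_conj_data T hI (hs b.1 b.2)
  choose h p d hb hd using hex
  rw [← Finset.card_attach]
  refine Finset.card_le_card_of_injOn (fun b => (p b, d b)) (fun _ _ => Finset.mem_univ _) ?_
  intro b _ b' _ hbb
  obtain ⟨hp, hd'⟩ := Prod.mk.inj hbb
  have hgroup : S.pathGroup T I (extendBits b.1) = S.pathGroup T I (extendBits b'.1) := by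
    refine S.pathGroup_eq_of_data T (h' := h b') (hb b) ?_ (hd b) ?_
    · rw [hp]; exact hb b'
    · rw [hp, hd']; exact hd b'
  have hstab := Subgroup.map_injective S.rho_injective hgroup
  refine Subtype.ext (funext fun k => ?_)
  have hk := k.2
  have h1 := T.eq_of_stab_eq S.cs hI hstab (k := k) (by omega)
  simpa [extendBits] using h1

end MirrorSystem

/-! ### Subgroups of given index -/

/-- A finitely generated Coxeter group has finitely many subgroups of a given finite index, since
such a subgroup is a point stabilizer of an action on a finite set. -/
theorem CoxeterSystem.finite_setOf_index_eq {B W : Type*} [Group W] {M : CoxeterMatrix B}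
    (cs : CoxeterSystem M W) [Finite B] {I : ℕ} (hI : I ≠ 0) :
    {H : Subgroup W | H.index = I}.Finite := by
  have : Finite (W →* Equiv.Perm (Fin I)) :=
    Finite.of_injective (fun φ : W →* Equiv.Perm (Fin I) => fun i => φ (cs.simple i))
      fun _ _ h => cs.ext_simple fun i => congrFun h i
  refine (Set.finite_range fun x : (W →* Equiv.Perm (Fin I)) × Fin I =>
    (MulAction.stabilizer (Equiv.Perm (Fin I)) x.2).comap x.1).subset ?_
  intro H hH
  have hH' : Nat.card (W ⧸ H) = I := hH
  have : Finite (W ⧸ H) := Nat.finite_of_card_ne_zero (hH' ▸ hI)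
  let e : W ⧸ H ≃ Fin I := Finite.equivFinOfCardEq hH'
  refine ⟨(e.permCongrHom.toMonoidHom.comp (MulAction.toPermHom W (W ⧸ H)),
    e (QuotientGroup.mk 1)), ?_⟩
  ext w
  have h1 : w ∈ (MulAction.stabilizer (Equiv.Perm (Fin I)) (e (QuotientGroup.mk 1))).comap
      (e.permCongrHom.toMonoidHom.comp (MulAction.toPermHom W (W ⧸ H))) ↔
      e (w • e.symm (e (QuotientGroup.mk 1))) = e (QuotientGroup.mk 1) := Iff.rfl
  rw [h1, e.symm_apply_apply, e.apply_eq_iff_eq, MulAction.Quotient.smul_mk, smul_eq_mul, mul_one,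
    eq_comm, QuotientGroup.eq, inv_one, one_mul]

/-- Polynomially many classes of a set of exponential size leave exponentially many classes. -/
theorem exists_exponential_lower_bound (f : ℕ → ℕ) (K d : ℕ) (h1 : ∀ I, 1 ≤ I → 1 ≤ f I)
    (h : ∀ I, 3 ≤ I → 2 ^ ((I - 3) / 2) ≤ K * I ^ d * f I) :
    ∃ c a : ℝ, 0 < c ∧ 1 < a ∧ ∀ I : ℕ, 1 ≤ I → c * a ^ I ≤ (f I : ℝ) := by
  obtain ⟨C, hC⟩ := (tendsto_pow_const_mul_const_pow_of_abs_lt_one d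
    (r := 9 / 10) (by rw [abs_of_pos] <;> norm_num)).bddAbove_range
  have hC' : ∀ I : ℕ, (I : ℝ) ^ d * (9 / 10) ^ I ≤ C := fun I => hC ⟨I, rfl⟩
  have hC0 : 0 < C := by
    have := hC' 1
    norm_num at this
    linarith
  -- The growth rate `√2` of the left-hand side is only needed above `4 / 3 = (6 / 5) / (9 / 10)`.
  have hroot : ∀ I : ℕ, 3 ≤ I → (4 / 3 : ℝ) ^ I ≤ 4 * 2 ^ ((I - 3) / 2) := by
    intro I hI
    have e1 : (4 / 3 : ℝ) ^ I ≤ (4 / 3) ^ (2 * ((I - 3) / 2) + 4) :=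
      pow_le_pow_right₀ (by norm_num) (by omega)
    have e2 : ((4 / 3 : ℝ) ^ 2) ^ ((I - 3) / 2) ≤ 2 ^ ((I - 3) / 2) :=
      pow_le_pow_left₀ (by norm_num) (by norm_num) _
    rw [pow_add, pow_mul] at e1
    have e3 : (0 : ℝ) ≤ 2 ^ ((I - 3) / 2) := by positivity
    nlinarith
  have hK : 0 < 4 * ((K : ℝ) + 1) * C := by positivity
  refine ⟨min (1 / (4 * (K + 1) * C)) (1 / 2), 6 / 5, ?_, by norm_num, fun I hI => ?_⟩
  · exact lt_min (by positivity) (by norm_num)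
  have hpos : (0 : ℝ) < (6 / 5) ^ I := by positivity
  have hf0 : (0 : ℝ) ≤ f I := Nat.cast_nonneg _
  rcases Nat.lt_or_ge I 3 with hlt | hge
  · have hf1 : (1 : ℝ) ≤ f I := by exact_mod_cast h1 I hI
    have hle : (6 / 5 : ℝ) ^ I ≤ (6 / 5) ^ 2 := pow_le_pow_right₀ (by norm_num) (by omega)
    calc min (1 / (4 * ((K : ℝ) + 1) * C)) (1 / 2) * (6 / 5) ^ I
        ≤ 1 / 2 * (6 / 5) ^ 2 :=
          mul_le_mul (min_le_right _ _) hle hpos.le (by norm_num)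
      _ ≤ 1 := by norm_num
      _ ≤ f I := hf1
  · have h2 : (2 : ℝ) ^ ((I - 3) / 2) ≤ K * (I : ℝ) ^ d * f I := by exact_mod_cast h I hge
    have h3 := hroot I hge
    have h4 : (6 / 5 : ℝ) ^ I = (4 / 3) ^ I * (9 / 10) ^ I := by
      rw [← mul_pow]; norm_num
    have h9 : (0 : ℝ) < (9 / 10) ^ I := by positivity
    have h5 : (6 / 5 : ℝ) ^ I ≤ 4 * (K + 1) * C * f I := by
      calc (6 / 5 : ℝ) ^ I = (4 / 3) ^ I * (9 / 10) ^ I := h4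
        _ ≤ (4 * (K * (I : ℝ) ^ d * f I)) * (9 / 10) ^ I :=
            mul_le_mul_of_nonneg_right (h3.trans (by linarith)) h9.le
        _ = 4 * K * f I * ((I : ℝ) ^ d * (9 / 10) ^ I) := by ring
        _ ≤ 4 * K * f I * C := mul_le_mul_of_nonneg_left (hC' I) (by positivity)
        _ ≤ 4 * (K + 1) * C * f I := by nlinarith [mul_nonneg hC0.le hf0]
    calc min (1 / (4 * ((K : ℝ) + 1) * C)) (1 / 2) * (6 / 5) ^ I
        ≤ 1 / (4 * ((K : ℝ) + 1) * C) * (4 * (K + 1) * C * f I) :=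
          mul_le_mul (min_le_left _ _) h5 hpos.le (by positivity)
      _ = f I := by field_simp

/-! ### Coxeter polyhedra -/

namespace HypPolyhedron

variable {n : ℕ} (Q : HypPolyhedron n)

theorem adjacent_symm {i j : Fin Q.numWalls} (h : Q.Adjacent i j) : Q.Adjacent j i := by
  obtain ⟨hij, x, hi, hj, hk⟩ := h
  exact ⟨hij.symm, x, hj, hi, fun k h1 h2 => hk k h2 h1⟩

theorem angle_symm (i j : Fin Q.numWalls) : Q.angle i j = Q.angle j i := by
  rw [angle, angle, mink_comm]

/-- Adjacent walls meet. -/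
theorem wall_inter_nonempty_of_adjacent {i j : Fin Q.numWalls} (h : Q.Adjacent i j) :
    (Q.wall i ∩ Q.wall j).Nonempty := by
  obtain ⟨_, x, hi, hj, hk⟩ := h
  have hx : x ∈ Q.carrier := by
    intro k
    by_cases hki : k = i
    · rw [hki, hi]
    by_cases hkj : k = j
    · rw [hkj, hj]
    exact (hk k hki hkj).le
  exact ⟨x, ⟨hx, hi⟩, ⟨hx, hj⟩⟩

theorem wall_nonempty (i : Fin Q.numWalls) : (Q.wall i).Nonempty := by
  obtain ⟨x, hi, hk⟩ := Q.wall_codim_one i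
  refine ⟨x, fun k => ?_, hi⟩
  by_cases hki : k = i
  · rw [hki, hi]
  · exact (hk k hki).le

/-- An angle strictly between `0` and `π` determines the product of the normals. -/
theorem mink_normal_eq_of_angle {i j : Fin Q.numWalls} {m : ℕ} (hm : 2 ≤ m)
    (h : Q.angle i j = Real.pi / m) :
    mink (Q.normal i) (Q.normal j) = -Real.cos (Real.pi / m) := by
  have hm2 : (2 : ℝ) ≤ m := by exact_mod_cast hm
  have hpos : 0 < Real.pi / m := div_pos Real.pi_pos (by linarith)
  have hlt : Real.pi / m < Real.pi := by
    rw [div_lt_iff₀ (by linarith)]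
    nlinarith [Real.pi_pos]
  rw [angle] at h
  have h1 : -1 ≤ -mink (Q.normal i) (Q.normal j) := by
    by_contra! hlt'
    rw [Real.arccos_of_le_neg_one hlt'.le] at h
    linarith
  have h2 : -mink (Q.normal i) (Q.normal j) ≤ 1 := by
    by_contra! hlt'
    rw [Real.arccos_of_one_le hlt'.le] at h
    linarith
  rw [← h, Real.cos_arccos h1 h2, neg_neg]

theorem mink_normal_nonpos_of_adjacent (hQ : Q.IsCoxeter) (i j : Fin Q.numWalls)
    (h : Q.Adjacent i j) : mink (Q.normal i) (Q.normal j) ≤ 0 := by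
  obtain ⟨m, hm, hang⟩ := hQ i j h
  rw [Q.mink_normal_eq_of_angle hm hang, neg_nonpos]
  have hm2 : (2 : ℝ) ≤ m := by exact_mod_cast hm
  refine Real.cos_nonneg_of_neg_pi_div_two_le_of_le ?_ ?_
  · have : 0 ≤ Real.pi / m := div_nonneg Real.pi_pos.le (by linarith)
    linarith [Real.pi_pos]
  · exact div_le_div_of_nonneg_left Real.pi_pos.le two_pos hm2

open Classical in
/-- The label of a pair of walls: the integer `m` if the walls are adjacent with angle `π / m`,
and `0`, which stands for an infinite label, if they are not adjacent. -/
noncomputable def label (i j : Fin Q.numWalls) : ℕ :=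
  if i = j then 1 else if Q.Adjacent i j then ⌊Real.pi / Q.angle i j⌋₊ else 0

theorem label_of_adjacent {i j : Fin Q.numWalls} (h : Q.Adjacent i j) {m : ℕ}
    (hang : Q.angle i j = Real.pi / m) : Q.label i j = m := by
  rw [label, if_neg h.1, if_pos h, hang, div_div_cancel₀ Real.pi_ne_zero, Nat.floor_natCast]

theorem label_of_not_adjacent {i j : Fin Q.numWalls} (hij : i ≠ j) (h : ¬ Q.Adjacent i j) :
    Q.label i j = 0 := by
  rw [label, if_neg hij, if_neg h]

theorem label_comm (i j : Fin Q.numWalls) : Q.label i j = Q.label j i := by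
  by_cases hij : i = j
  · rw [hij]
  by_cases h : Q.Adjacent i j
  · rw [label, label, if_neg hij, if_neg (Ne.symm hij), if_pos h, if_pos (Q.adjacent_symm h),
      Q.angle_symm]
  · rw [Q.label_of_not_adjacent hij h,
      Q.label_of_not_adjacent (Ne.symm hij) fun h' => h (Q.adjacent_symm h')]

/-- The mirrors of a Coxeter polyhedron. -/
noncomputable def mirrorSystem (hQ : Q.IsCoxeter) : MirrorSystem n (Fin Q.numWalls) where
  M :=
    { M := Q.label
      isSymm := Matrix.IsSymm.ext fun i j => Q.label_comm j i
      diagonal := fun i => if_pos rfl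
      off_diagonal := fun i j hij => by
        by_cases h : Q.Adjacent i j
        · obtain ⟨m, hm, hang⟩ := hQ i j h
          rw [Q.label_of_adjacent h hang]
          omega
        · rw [Q.label_of_not_adjacent hij h]
          exact zero_ne_one }
  e := Q.normal
  unit := Q.normal_unit
  base := Q.interior_nonempty.choose
  base_neg := Q.interior_nonempty.choose_spec
  gram i j hij := by
    change (Q.label i j ≠ 0 ∧ _ = -Real.cos (Real.pi / Q.label i j)) ∨ (Q.label i j = 0 ∧ _)
    by_cases h : Q.Adjacent i j
    · left
      obtain ⟨m, hm, hang⟩ := hQ i j h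
      rw [Q.label_of_adjacent h hang]
      exact ⟨by omega, Q.mink_normal_eq_of_angle hm hang⟩
    · right
      refine ⟨Q.label_of_not_adjacent hij h, ?_⟩
      by_contra! hlt
      exact h (Q.adjacent_of_mink_gt (Q.mink_normal_nonpos_of_adjacent hQ) hij hlt)

/-- Three pairwise disjoint doubling walls. -/
def doublingTriple (hQ : Q.IsCoxeter) (w : Fin 3 → Fin Q.numWalls)
    (hdoubling : ∀ a, Q.IsDoublingWall (w a))
    (hdisj : ∀ a b, a ≠ b → Disjoint (Q.wall (w a)) (Q.wall (w b))) :
    DoublingTriple (Q.mirrorSystem hQ).M where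
  w := w
  infinite_label a b hab := by
    have hd := hdisj a b hab
    refine Q.label_of_not_adjacent ?_ fun hadj => ?_
    · intro h
      rw [h, disjoint_self] at hd
      exact (Q.wall_nonempty (w b)).ne_empty hd
    · exact (Q.wall_inter_nonempty_of_adjacent hadj).ne_empty hd.inter_eq
  even_label a j hj := by
    change Even (Q.label (w a) j)
    by_cases h : Q.Adjacent (w a) j
    · obtain ⟨m, _, hang⟩ := hdoubling a j (hj a).symm (Q.wall_inter_nonempty_of_adjacent h)
      rw [Q.label_of_adjacent h hang]
      exact even_two_mul m
    · rw [Q.label_of_not_adjacent (hj a) h]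
      exact Even.zero

theorem range_rho (hQ : Q.IsCoxeter) : (Q.mirrorSystem hQ).rho.range = Q.coxeterGroup := by
  rw [MonoidHom.range_eq_map, ← (Q.mirrorSystem hQ).cs.subgroup_closure_range_simple,
    MonoidHom.map_closure, coxeterGroup, ← Set.range_comp]
  exact congrArg _ (congrArg _ (funext (Q.mirrorSystem hQ).rho_simple))

/-- The stabilizers of the vertices of a coloured path are reflection subgroups. -/
theorem map_stab_mem_reflectionSubgroups (hQ : Q.IsCoxeter)
    (P : ColouredPath (Q.mirrorSystem hQ).M) {I p : ℕ} (hp : p < I) :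
    (P.stab I (Q.mirrorSystem hQ).cs p).map (Q.mirrorSystem hQ).rho ∈ Q.reflectionSubgroups I := by
  refine ⟨?_, ?_, ?_⟩
  · rw [← Q.range_rho hQ]
    exact Subgroup.map_le_range _ _
  · rw [← Q.range_rho hQ, MonoidHom.range_eq_map,
      Subgroup.relIndex_map_map_of_injective _ _ (Q.mirrorSystem hQ).rho_injective,
      Subgroup.relIndex_top_right, P.index_stab I _ hp]
  · refine ⟨(Q.mirrorSystem hQ).rho ''
      {x | ∃ q c, q < I ∧ P.step I c q = q ∧ x = P.wallReflection (Q.mirrorSystem hQ).cs p q c},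
      ?_, ?_⟩
    · rintro _ ⟨_, ⟨q, c, _, _, rfl⟩, rfl⟩
      exact ⟨_, _, (Q.mirrorSystem hQ).rho_conj_simple _ c⟩
    · rw [← MonoidHom.map_closure, ← P.stab_eq_closure I _ hp]

theorem finite_reflectionSubgroups (hQ : Q.IsCoxeter) {I : ℕ} (hI : I ≠ 0) :
    (Q.reflectionSubgroups I).Finite := by
  refine Set.Finite.of_finite_image (f := Subgroup.comap (Q.mirrorSystem hQ).rho)
    (((Q.mirrorSystem hQ).cs.finite_setOf_index_eq hI).subset ?_) ?_
  · rintro _ ⟨G, hG, rfl⟩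
    rw [Set.mem_ofPred_eq, Subgroup.index_comap, Q.range_rho hQ]
    exact hG.2.1
  · intro G hG G' hG' h
    have h1 := hG.1
    have h2 := hG'.1
    rw [← Q.range_rho hQ] at h1 h2
    rw [← Subgroup.map_comap_eq_self h1, ← Subgroup.map_comap_eq_self h2]
    exact congrArg _ h

end HypPolyhedron

theorem theorem4p3 (n : ℕ) (Q : HypPolyhedron n) (hQ : Q.IsCoxeter)
    (hvol : hypVolume Q.carrier < ∞)
    (w₁ w₂ w₃ : Fin Q.numWalls)
    (h₁ : Q.IsDoublingWall w₁) (h₂ : Q.IsDoublingWall w₂) (h₃ : Q.IsDoublingWall w₃)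
    (h₁₂ : Disjoint (Q.wall w₁) (Q.wall w₂)) (h₁₃ : Disjoint (Q.wall w₁) (Q.wall w₃))
    (h₂₃ : Disjoint (Q.wall w₂) (Q.wall w₃)) :
    ∃ c a : ℝ, 0 < c ∧ 1 < a ∧
      ∀ I : ℕ, 1 ≤ I → c * a ^ I ≤ (numReflectionSubgroups Q I : ℝ) := by
  classical
  set S := Q.mirrorSystem hQ with hS
  let T : DoublingTriple S.M := Q.doublingTriple hQ ![w₁, w₂, w₃]
    (fun a => by fin_cases a <;> assumption)
    (fun a b hab => by
      fin_cases a <;> fin_cases b <;>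
        first
        | exact absurd rfl hab
        | assumption
        | exact Disjoint.symm (by assumption))
  have hfin : ∀ I, 1 ≤ I → Finite (Quotient ((isomConj n).comap
      (Subtype.val : Q.reflectionSubgroups I → Subgroup (HypIsom n)))) := by
    intro I hI
    have := (Q.finite_reflectionSubgroups hQ (I := I) (by omega)).to_subtype
    infer_instance
  refine exists_exponential_lower_bound (numReflectionSubgroups Q)
    (Q.numWalls ^ Q.numWalls) (Q.numWalls + 1) (fun I hI => ?_) (fun I hI => ?_)
  · have := hfin I hI
    have : Nonempty (Quotient ((isomConj n).comap
        (Subtype.val : Q.reflectionSubgroups I → Subgroup (HypIsom n)))) :=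
      ⟨Quotient.mk _ ⟨_, Q.map_stab_mem_reflectionSubgroups hQ (T.bitPath fun _ => false)
        (show 0 < I by omega)⟩⟩
    exact Nat.card_pos
  · have := hfin I (by omega)
    have := Fintype.ofFinite (Quotient ((isomConj n).comap
      (Subtype.val : Q.reflectionSubgroups I → Subgroup (HypIsom n))))
    let cls : (Fin ((I - 3) / 2) → Bool) → Quotient ((isomConj n).comap
        (Subtype.val : Q.reflectionSubgroups I → Subgroup (HypIsom n))) := fun b =>
      Quotient.mk _ ⟨S.pathGroup T I (MirrorSystem.extendBits b),
        Q.map_stab_mem_reflectionSubgroups hQ _ (by omega)⟩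
    have hcount := Finset.card_le_mul_card_image_of_maps_to (f := cls)
      (s := Finset.univ) (t := Finset.univ) (fun _ _ => Finset.mem_univ _)
      (I * (I * Q.numWalls) ^ Q.numWalls) (fun C _ => by
        rcases Finset.eq_empty_or_nonempty (Finset.univ.filter fun b => cls b = C) with h | ⟨a, ha⟩
        · rw [h]; exact Nat.zero_le _
        · have hle := S.card_le_of_conj T hI (Finset.univ.filter fun b => cls b = C) a
            (fun b hb => by
              have e1 := (Finset.mem_filter.mp hb).2
              have e2 := (Finset.mem_filter.mp ha).2
              exact Quotient.exact (s := (isomConj n).comap (Subtype.val :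
                Q.reflectionSubgroups I → Subgroup (HypIsom n))) (e1.trans e2.symm))
          rwa [Fintype.card_fin] at hle)
    rw [Finset.card_univ, Finset.card_univ, Fintype.card_fun, Fintype.card_bool, Fintype.card_fin,
      ← Nat.card_eq_fintype_card] at hcount
    refine hcount.trans (le_of_eq ?_)
    rw [numReflectionSubgroups, mul_pow]
    ring
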